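/- \textbf{Model I.} Let $\bar C_t,D_t,S_t>0$ be aggregate consumption, dividends and the stock price, $\varepsilon_{c,t}=\bar C_t/\bar C_{t-1}$, $Y_t=\bar C_t/D_t$, $R_{S,t+1}=(S_{t+1}+D_{t+1})/S_t$, let $R_{f,t+1}>0$ be the gross risk-free return, known at time $t$, and let $\mathcal F_t$ be generated by aggregate consumption and dividends up to time $t$, $\mathbb E_t=\mathbb E[\,\cdot\mid\mathcal F_t]$. Assume that $\varepsilon_{c,t+1}$ is independent of $\mathcal F_t$ with a distribution that does not depend on $t$, has continuous c.d.f. $F_{\varepsilon_c}$, and satisfies $\mathbb E|m(\varepsilon_{c,t})|<\infty$ and the growth condition $\beta\,\mathbb E[\varepsilon_{c,t+1}^{1-\theta}]<1$; here $\beta,\theta>0$, $b,\gamma\ge0$, $\lambda\ge1$, $m(x)=x^{1-\theta}/(1-\theta)$ ($m=\log$ if $\theta=1$), and $\mu(x)=x$ for $x\ge0$, $\mu(x)=\lambda x$ for $x<0$. An agent with wealth $W_{t+1}=(W_t-C_t)(\alpha_tR_{S,t+1}+(1-\alpha_t)R_{f,t+1})+\bar C_{t+1}-D_{t+1}$ chooses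 adapted $C_t,\alpha_t$, keeping $C_t,W_t>0$, to maximize $\mathbb E_t\sum_{s\ge t}\beta^{s-t}\tilde U_s$ at each date $t$, where $$\tilde U_t=U_t(C_t)+\gamma\sum_{s\ge1}\beta^s\mathbb E_t[\tilde U_{t,t+s}],\quad U_t(c)=m(c)+b\,\mathbb E_t[\mu(m(c)-m(\tilde C_{t-1,t}))],\quad \tilde U_{t,t+s}=\mu\big(m(\hat C_{t,t+s})-m(\hat C_{t-1,t+s})\big).$$ With $C^\star,\alpha^\star,W^\star$ the optimal plan, $\tilde C_{t-1,t}$ is distributed as $C^\star_t$ given $\mathcal F_{t-1}$ and is otherwise independent of the consumption and dividend paths; $\hat C_{t,t+s}=\frac{C^\star_{t+s}}{W^\star_{t+s}}\big(\prod_{i=2}^s\frac{W^\star_{t+i}}{W^\star_{t+i-1}}\big)W_{t+1}$; and $\hat C_{t-1,t+s}=C^\star_{t-1}\tilde\varepsilon_{c,t}C^\star_{t+s}/C^\star_t$, with $\tilde\varepsilon_{c,t}$ distributed as $C^\star_t/C^\star_{t-1}$ given $\mathcal F_{t-1}$ and otherwise independent of these paths. The economy is in equilibrium: $C_t^\star=\bar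 C_t$ and $\alpha_t^\star=1$, the initial wealth being $W^\star_0=S_0+\bar C_0$. The price-dividend ratio $S_t/D_t$ is a function of $(\varepsilon_{c,t},Y_t)$. Write $G(x)=1+bF_{\varepsilon_c}(x)+b\lambda(1-F_{\varepsilon_c}(x))$, $\Phi(x)=F_{\varepsilon_c}(x)+\lambda(1-F_{\varepsilon_c}(x))$ and $k=1-\beta\,\mathbb E[\varepsilon_{c,t+1}^{1-\theta}]$. Let the stochastic discount factor be the intertemporal marginal rate of substitution $$M_{t+1}=\frac{\beta U_{t+1}'(\bar C_{t+1})+\gamma\sum_{s\ge1}\beta^s\,\mathbb E_{t+1}\!\left[\partial\tilde U_{t,t+s}/\partial W_{t+1}\big|_{W_{t+1}=W^\star_{t+1}}\right]}{U_t'(\bar C_t)} ,$$ where the reference points inside $\tilde U_{t,t+s}$ are averaged over $\tilde\varepsilon_{c,t}$ before differentiating. \textbf{Claim.} There is a function $h$ with $S_t/D_t=h(\varepsilon_{c,t},Y_t)/(G(\varepsilon_{c,t})\,k)$ such that almost surely, for every date $t$, $$M_{t+1}=\frac{\beta}{G(\varepsilon_{c,t})}\left(\varepsilon_{c,t+1}^{-\theta}G(\varepsilon_{c,t+1})+\gamma\,\varepsilon_{c,t+1}^{-\theta}Y_{t+1}\frac{\Phi(\varepsilon_{c,t})\,G(\varepsilon_{c,t+1})}{Y_{t+1}G(\varepsilon_{c,t+1})\,k+h(\varepsilon_{c,t+1},Y_{t+1})}\right).$$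 Moreover, for an asset with return $R\in\{R_S,R_f\}$ and a date $t$ at which small trades in both directions are feasible (there is an $\mathcal F_t$-measurable $\delta>0$ with $\delta R_{t+1}\le\bar C_{t+1}$), $\mathbb E_t[M_{t+1}R_{t+1}]=1$; and when this holds for the stock, $h$ solves $$h(\varepsilon_{c,t},Y_t)=\gamma\Phi(\varepsilon_{c,t})\beta\,\mathbb E_t\!\left[\varepsilon_{c,t+1}^{1-\theta}Y_t\frac{G(\varepsilon_{c,t+1})k+h(\varepsilon_{c,t+1},Y_{t+1})}{Y_{t+1}G(\varepsilon_{c,t+1})k+h(\varepsilon_{c,t+1},Y_{t+1})}\right]+\beta\,\mathbb E_t\!\left[\varepsilon_{c,t+1}^{1-\theta}\frac{Y_t}{Y_{t+1}}\big(h(\varepsilon_{c,t+1},Y_{t+1})+G(\varepsilon_{c,t+1})k\big)\right].$$ -/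

import Mathlib

open MeasureTheory ProbabilityTheory
open scoped ENNReal

noncomputable section

namespace ModelI

/-- Preference parameters: discount factor `β`, relative risk aversion `θ`, weight `b` of
contemporaneous gain-loss utility, degree of loss aversion `lam`, weight `γ` of prospective
gain-loss utility. -/
structure Params where
  β : ℝ
  θ : ℝ
  b : ℝ
  lam : ℝ
  γ : ℝ
  β_pos : 0 < β
  θ_pos : 0 < θ
  b_nonneg : 0 ≤ b
  one_le_lam : 1 ≤ lam
  γ_nonneg : 0 ≤ γ

/-- Power utility of consumption. -/
def Params.m (a : Params) (x : ℝ) : ℝ :=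
  if a.θ = 1 then Real.log x else x ^ (1 - a.θ) / (1 - a.θ)

/-- Piecewise linear gain-loss utility. -/
def Params.mu (a : Params) (x : ℝ) : ℝ := if 0 ≤ x then x else a.lam * x

variable {Ω : Type*} [MeasurableSpace Ω]

/-- Aggregate consumption, dividends, stock price, and gross risk-free return
(`Rf t` is the return over the period from `t - 1` to `t`). -/
structure Market (Ω : Type*) where
  Cbar : ℕ → Ω → ℝ
  D : ℕ → Ω → ℝ
  S : ℕ → Ω → ℝ
  Rf : ℕ → Ω → ℝ

namespace Market

/-- Consumption growth rate `ε_{c,t}` (used for `t ≥ 1`). -/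
def growth (X : Market Ω) (t : ℕ) (ω : Ω) : ℝ := X.Cbar t ω / X.Cbar (t - 1) ω

/-- Consumption-dividend ratio `Y_t`. -/
def ratio (X : Market Ω) (t : ℕ) (ω : Ω) : ℝ := X.Cbar t ω / X.D t ω

/-- Gross stock return `R_{S,t}` over the period from `t - 1` to `t` (used for `t ≥ 1`). -/
def RS (X : Market Ω) (t : ℕ) (ω : Ω) : ℝ := (X.S t ω + X.D t ω) / X.S (t - 1) ω

/-- Labor income `L_t`. -/
def labor (X : Market Ω) (t : ℕ) (ω : Ω) : ℝ := X.Cbar t ω - X.D t ω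

/-- Information at time `t`, generated by aggregate consumption and dividends up to `t`. -/
def info (X : Market Ω) (t : ℕ) : MeasurableSpace Ω :=
  ⨆ s ∈ Set.Iic t, MeasurableSpace.comap (fun ω => (X.Cbar s ω, X.D s ω)) inferInstance

/-- Standing assumptions: positive consumption, dividends and prices; prices known when they are
quoted; consumption growth i.i.d. and independent of the past. -/
structure Standing (X : Market Ω) (P : Measure Ω) : Prop where
  measurable_Cbar : ∀ t, Measurable (X.Cbar t)
  measurable_D : ∀ t, Measurable (X.D t)
  measurable_S : ∀ t, Measurable[X.info t] (X.S t)
  measurable_Rf : ∀ t, Measurable[X.info t] (X.Rf (t + 1))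
  Cbar_pos : ∀ t ω, 0 < X.Cbar t ω
  D_pos : ∀ t ω, 0 < X.D t ω
  S_pos : ∀ t ω, 0 < X.S t ω
  Rf_pos : ∀ t ω, 0 < X.Rf (t + 1) ω
  growth_indep : ∀ t,
    Indep (MeasurableSpace.comap (X.growth (t + 1)) inferInstance) (X.info t) P
  growth_law : ∀ t, P.map (X.growth (t + 1)) = P.map (X.growth 1)

end Market

/-- A plan: consumption, fraction of post-consumption wealth held in the stock, and the wealth
(before consumption) that results. -/
structure Plan (Ω : Type*) where
  C : ℕ → Ω → ℝ
  α : ℕ → Ω → ℝ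
  W : ℕ → Ω → ℝ

/-- Adapted plans that satisfy the wealth equation, start from one share of the stock and the
current income, and keep consumption and wealth positive. -/
structure Feasible (P : Measure Ω) (X : Market Ω) (q : Plan Ω) : Prop where
  adapted_C : ∀ t, Measurable[X.info t] (q.C t)
  adapted_α : ∀ t, Measurable[X.info t] (q.α t)
  initial : ∀ ω, q.W 0 ω = X.S 0 ω + X.D 0 ω + X.labor 0 ω
  budget : ∀ t ω, q.W (t + 1) ω =
    (q.W t ω - q.C t ω) * (q.α t ω * X.RS (t + 1) ω + (1 - q.α t ω) * X.Rf (t + 1) ω)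
      + X.labor (t + 1) ω
  C_pos : ∀ t, ∀ᵐ ω ∂P, 0 < q.C t ω
  W_pos : ∀ t, ∀ᵐ ω ∂P, 0 < q.W t ω

section Formula

variable (a : Params) (P : Measure Ω) (X : Market Ω)

/-- Cumulative distribution function `F_{ε_c}` of the consumption growth rate. -/
def F (x : ℝ) : ℝ := cdf (P.map (X.growth 1)) x

/-- `F_{ε_c}(x) + λ (1 - F_{ε_c}(x))`. -/
def Φ (x : ℝ) : ℝ := F P X x + a.lam * (1 - F P X x)

/-- `1 + b F_{ε_c}(x) + b λ (1 - F_{ε_c}(x))`. -/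
def G (x : ℝ) : ℝ := 1 + a.b * F P X x + a.b * a.lam * (1 - F P X x)

/-- `1 - β 𝔼[ε_c ^ (1 - θ)]`. -/
def growthGap : ℝ := 1 - a.β * ∫ ω, X.growth 1 ω ^ (1 - a.θ) ∂P

/-- Small trades at time `t` in both directions, in an asset with return `R`, are feasible:
a small enough short position can be covered out of consumption at `t + 1`. -/
def TwoSidedTrade (R : ℕ → Ω → ℝ) (t : ℕ) : Prop :=
  ∃ δ : Ω → ℝ, Measurable[X.info t] δ ∧ (∀ ω, 0 < δ ω) ∧
    ∀ᵐ ω ∂P, δ ω * R (t + 1) ω ≤ X.Cbar (t + 1) ω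

end Formula

variable [StandardBorelSpace Ω]

/-- Conditional expectation `𝔼_t[f]`, through the regular conditional distribution given the
information at time `t`. -/
def condE (P : Measure Ω) [IsFiniteMeasure P] (X : Market Ω) (t : ℕ) (f : Ω → ℝ) (ω : Ω) : ℝ :=
  ∫ ω', f ω' ∂(condExpKernel P (X.info t) ω)

/-- The same for functions with values in `[0, ∞]`. -/
def condLE (P : Measure Ω) [IsFiniteMeasure P] (X : Market Ω) (t : ℕ) (f : Ω → ℝ≥0∞) (ω : Ω) :
    ℝ≥0∞ :=
  ∫⁻ ω', f ω' ∂(condExpKernel P (X.info t) ω)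

section Preferences

variable (a : Params) (P : Measure Ω) [IsFiniteMeasure P] (X : Market Ω)

/- In this section `p` is the plan that the agent expects to follow (the optimal plan `C⋆`, `W⋆`);
her beliefs are formed from it. The reference points are independent of the realized path `ω`
given the information at `t - 1`, so they are averaged over a separate variable `ω'`. -/
variable (p : Plan Ω)

/-- Consumption utility plus contemporaneous gain-loss utility `U_t(c)`. The reference point is
distributed as `C⋆_t` conditional on the information at `t - 1`. -/
def U (t : ℕ) (c : ℝ) (ω : Ω) : ℝ :=
  a.m c + a.b * condE P X (t - 1) (fun ω' => a.mu (a.m c - a.m (p.C t ω'))) ω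

/-- Time-`t` belief about consumption at `t + s`, if wealth at `t + 1` is `w`: linear consumption
rule with propensities `C⋆/W⋆` and wealth growth rates `W⋆_{t+i}/W⋆_{t+i-1}`. -/
def Chat (t s : ℕ) (w : ℝ) (ω : Ω) : ℝ :=
  p.C (t + s) ω / p.W (t + s) ω
    * (∏ i ∈ Finset.Icc 2 s, p.W (t + i) ω / p.W (t + i - 1) ω) * w

/-- Time-`(t-1)` belief about consumption at `t + s`, if `e` is the drawn growth rate. -/
def CrefHat (t s : ℕ) (e : ℝ) (ω : Ω) : ℝ :=
  p.C (t - 1) ω * e * (p.C (t + s) ω / p.C t ω)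

/-- Realized prospective gain-loss utility `μ(m(Ĉ_{t,t+s}) - m(Ĉ_{t-1,t+s}))` along the path `ω`,
with growth rate in the reference point drawn along `ω'`. -/
def prospAt (t s : ℕ) (w : ℝ) (ω ω' : Ω) : ℝ :=
  a.mu (a.m (Chat p t s w ω) - a.m (CrefHat p t s (p.C t ω' / p.C (t - 1) ω') ω))

/-- Prospective gain-loss utility along `ω`, averaged over the reference growth rate, which is
distributed as `C⋆_t / C⋆_{t-1}` conditional on the information at `t - 1`. -/
def prosp (t s : ℕ) (w : ℝ) (ω : Ω) : ℝ :=
  condE P X (t - 1) (fun ω' => prospAt a p t s w ω ω') ω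

/-- Total period utility of the plan `q`. -/
def Utilde (q : Plan Ω) (t : ℕ) (ω : Ω) : ℝ :=
  U a P X p t (q.C t ω) ω
    + a.γ * ∑' i : ℕ, a.β ^ (i + 1)
        * condE P X t (fun ω₁ => prosp a P X p t (i + 1) (q.W (t + 1) ω₁) ω₁) ω

/-- Cumulative utility of the plan `q` from time `t` on. -/
def V (q : Plan Ω) (t : ℕ) (ω : Ω) : ℝ :=
  condE P X t (fun ω₁ => ∑' k : ℕ, a.β ^ k * Utilde a P X p q (t + k) ω₁) ω

/-- `Utilde` with all terms replaced by their absolute values. -/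
def absUtilde (q : Plan Ω) (t : ℕ) (ω : Ω) : ℝ≥0∞ :=
  ‖a.m (q.C t ω)‖ₑ
    + ENNReal.ofReal a.b
        * condLE P X (t - 1) (fun ω' => ‖a.mu (a.m (q.C t ω) - a.m (p.C t ω'))‖ₑ) ω
    + ENNReal.ofReal a.γ * ∑' i : ℕ, ENNReal.ofReal (a.β ^ (i + 1))
        * condLE P X t (fun ω₁ => condLE P X (t - 1)
            (fun ω' => ‖prospAt a p t (i + 1) (q.W (t + 1) ω₁) ω₁ ω'‖ₑ) ω₁) ω

/-- All expectations and series in the cumulative utility from `t` on converge absolutely. -/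
def HasFiniteUtility (q : Plan Ω) (t : ℕ) : Prop :=
  ∀ᵐ ω ∂P, condLE P X t
    (fun ω₁ => ∑' k : ℕ, ENNReal.ofReal (a.β ^ k) * absUtilde a P X p q (t + k) ω₁) ω < ∞

/-- Equilibrium with plan `p`: markets clear, beliefs are formed from `p`, and at each date `p`
maximizes cumulative utility among all feasible continuations. -/
structure IsEquilibrium : Prop where
  feasible : Feasible P X p
  clearing_endowment : ∀ t ω, p.C t ω = X.Cbar t ω
  clearing_stock : ∀ t ω, p.α t ω = 1
  finite : ∀ t, 1 ≤ t → HasFiniteUtility a P X p p t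
  optimal : ∀ t, 1 ≤ t → ∀ q : Plan Ω, Feasible P X q →
    (∀ s, s < t → q.C s = p.C s ∧ q.α s = p.α s) → HasFiniteUtility a P X p q t →
    ∀ᵐ ω ∂P, V a P X p q t ω ≤ V a P X p p t ω

/-- The stochastic discount factor `M_{t+1}`, as the intertemporal marginal rate of substitution at
the plan `p`: the time-`t` marginal utility of one more unit of wealth at `t + 1` that is consumed
at `t + 1` (discounted marginal utility of consumption at `t + 1`, and marginal prospective
gain-loss utility at `t`), relative to the marginal utility of consumption at `t`. -/
def sdf (t : ℕ) (ω : Ω) : ℝ :=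
  (a.β * deriv (fun c => U a P X p (t + 1) c ω) (p.C (t + 1) ω)
    + a.γ * ∑' i : ℕ, a.β ^ (i + 1) * condE P X (t + 1)
        (fun ω₁ => deriv (fun w => prosp a P X p t (i + 1) w ω₁) (p.W (t + 1) ω₁)) ω)
  / deriv (fun c => U a P X p t c ω) (p.C t ω)

end Preferences

section IntegralEquation

variable (a : Params) (P : Measure Ω) [IsFiniteMeasure P] (X : Market Ω) (h : ℝ → ℝ → ℝ)

/-- The integrand of the prospective term in the integral equation for `h`. -/
def prospIntegrand (t : ℕ) (ω : Ω) : ℝ :=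
  X.growth (t + 1) ω ^ (1 - a.θ) * X.ratio t ω *
    ((G a P X (X.growth (t + 1) ω) * growthGap a P X
        + h (X.growth (t + 1) ω) (X.ratio (t + 1) ω)) /
      (X.ratio (t + 1) ω * G a P X (X.growth (t + 1) ω) * growthGap a P X
        + h (X.growth (t + 1) ω) (X.ratio (t + 1) ω)))

/-- The integrand of the standard term in the integral equation for `h`. -/
def baseIntegrand (t : ℕ) (ω : Ω) : ℝ :=
  X.growth (t + 1) ω ^ (1 - a.θ) * (X.ratio t ω / X.ratio (t + 1) ω) *
    (h (X.growth (t + 1) ω) (X.ratio (t + 1) ω)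
      + G a P X (X.growth (t + 1) ω) * growthGap a P X)

/-- The integral equation for `h` at time `t` (with existence of the conditional expectations). -/
def SolvesIntegralEquation (t : ℕ) : Prop :=
  ∀ᵐ ω ∂P,
    Integrable (prospIntegrand a P X h t) (condExpKernel P (X.info t) ω) ∧
    Integrable (baseIntegrand a P X h t) (condExpKernel P (X.info t) ω) ∧
    h (X.growth t ω) (X.ratio t ω) =
      a.γ * Φ a P X (X.growth t ω) * (a.β * condE P X t (prospIntegrand a P X h t) ω)
        + a.β * condE P X t (baseIntegrand a P X h t) ω

end IntegralEquation

end ModelI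

end

/-! In equilibrium wealth is `S + C̄`, and for almost every path the growth rate `ε_{t+1}` keeps its
unconditional law `ν` under the regular conditional distribution given the information at `t`. Both
utility terms therefore reduce to one real function, `gainLoss`, namely `c ↦ ∫ μ(m(c) - m(k e))
dν(e)`. Contemporaneous utility at `t` has `k = C̄_{t-1}`. In the prospective term the wealth growth
factors telescope, so that `c = C̄_{t+s} w / W_{t+1}` and `k = C̄_{t-1} C̄_{t+s} / C̄_t`.

Since `ν` has no atoms, the kink of `μ` is met with probability zero, and `hasDerivAt_gainLoss`
gives the slope `c^(-θ) (F(c/k) + λ (1 - F(c/k)))`. At equilibrium `c/k = ε_t` in both terms and at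
every horizon, so the marginal prospective utility of wealth is `Φ(ε_t) C̄_{t+s}^(1-θ) / W_{t+1}`.
Conditioning at `t + 1` leaves one factor `𝔼[ε^(1-θ)]` for each further period. The discounted sum
is geometric, which is how `growthGap` enters `sdf_eq`.

The Euler equation is a variational argument. Invest `x δ` at one date, consume the payoff at the
next, and leave wealth unchanged afterwards; only two period utilities change
(`SmallTrade.V_sub_V`). The trade is capped so that consumption moves by at most one half of its
equilibrium value. In that range `m` is Lipschitz in `x` with a constant of order `C̄^(1-θ)`, whose
discounted conditional expectations are summable by the growth condition. This one estimate makes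
the perturbed utility finite and dominates every differentiation under integrals and series.
Optimality at `x = ±1/(n+1)` forces the derivative at `0` to vanish (`SmallTrade.first_order`), and
dividing by marginal utility gives `SmallTrade.condE_sdf_mul`.

Finally `h` is `S/D` times `G` times `growthGap`. Multiplying the Euler equation of the stock by the
known quantity `h(ε_t, Y_t)` yields the integral equation. The bound `δ R_S ≤ C̄` supplies the
integrability of its two terms. -/

namespace ModelI

/-! ### Conditional expectation through regular conditional distributions -/

section Kernel

variable {Ω : Type*} {m m' : MeasurableSpace Ω} [mΩ : MeasurableSpace Ω] [StandardBorelSpace Ω]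
  {P : Measure Ω} [IsFiniteMeasure P]

theorem ae_ae_condExpKernel (hm : m ≤ mΩ) {p : Ω → Prop} (hp : ∀ᵐ ω ∂P, p ω) :
    ∀ᵐ ω ∂P, ∀ᵐ ω' ∂(condExpKernel P m ω), p ω' := by
  refine ae_of_ae_trim hm (Measure.ae_ae_of_ae_comp ?_)
  rwa [condExpKernel_comp_trim hm]

theorem measurable_lintegral_condExpKernel {f : Ω → ℝ≥0∞} (hf : Measurable f) :
    Measurable[m] fun ω => ∫⁻ ω', f ω' ∂(condExpKernel P m ω) :=
  hf.lintegral_kernel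

theorem measurable_lintegral_condExpKernel_prod (hm : m ≤ mΩ) {f : Ω → Ω → ℝ≥0∞}
    (hf : Measurable (Function.uncurry f)) :
    Measurable fun ω => ∫⁻ ω', f ω ω' ∂(condExpKernel P m ω) := by
  have := hf.lintegral_kernel_prod_right'
    (κ := (condExpKernel P m).comap id (measurable_id'' hm))
  simpa only [Kernel.comap_apply, id_eq, Function.uncurry_apply_pair] using this

theorem measurable_integral_condExpKernel_prod (hm : m ≤ mΩ) {f : Ω → Ω → ℝ}
    (hf : Measurable (Function.uncurry f)) :
    Measurable fun ω => ∫ ω', f ω ω' ∂(condExpKernel P m ω) := by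
  have := hf.stronglyMeasurable.integral_kernel_prod_right'
    (κ := (condExpKernel P m).comap id (measurable_id'' hm))
  simpa only [Kernel.comap_apply, id_eq, Function.uncurry_apply_pair] using this.measurable

/-- The law of `(ω, ω)`, with the first coordinate seen only through `m`, disintegrates into the
trimmed measure followed by the kernel. This is why `f` has to be measurable for `m.prod mΩ`. -/
theorem lintegral_condExpKernel_diag (hm : m ≤ mΩ) {f : Ω × Ω → ℝ≥0∞}
    (hf : Measurable[m.prod mΩ] f) :
    ∫⁻ ω, ∫⁻ ω', f (ω, ω') ∂(condExpKernel P m ω) ∂P = ∫⁻ ω, f (ω, ω) ∂P := by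
  have h1 := @Measure.lintegral_compProd Ω Ω m mΩ (P.trim hm) (condExpKernel P m) _ _ f hf
  have h0 : @Measurable Ω (Ω × Ω) mΩ (m.prod mΩ) Function.diag :=
    (measurable_id'' hm).prodMk measurable_id
  have h2 := @lintegral_map Ω (Ω × Ω) mΩ (m.prod mΩ) P f Function.diag hf h0
  rw [compProd_trim_condExpKernel hm, h2, lintegral_trim hm] at h1
  · exact h1.symm
  · exact @Measurable.lintegral_kernel_prod_right Ω Ω m mΩ (condExpKernel P m) _
      (fun a b => f (a, b)) hf

theorem ae_ae_condExpKernel_diag (hm : m ≤ mΩ) {s : Set (Ω × Ω)}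
    (hs : MeasurableSet[m.prod mΩ] s) (h : ∀ᵐ ω ∂P, (ω, ω) ∈ s) :
    ∀ᵐ ω ∂P, ∀ᵐ ω' ∂(condExpKernel P m ω), (ω, ω') ∈ s := by
  have h0 : @Measurable Ω (Ω × Ω) mΩ (m.prod mΩ) Function.diag :=
    (measurable_id'' hm).prodMk measurable_id
  refine ae_of_ae_trim hm (@Measure.ae_ae_of_ae_compProd Ω Ω m mΩ (P.trim hm)
    (condExpKernel P m) _ _ (fun x => x ∈ s) ?_)
  rw [compProd_trim_condExpKernel hm]
  exact (@ae_map_iff Ω (Ω × Ω) mΩ (m.prod mΩ) P Function.diag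
    (@Measurable.aemeasurable Ω (Ω × Ω) mΩ (m.prod mΩ) _ P h0) (fun x => x ∈ s) hs).2 h

/-- The diagonal satisfies `f x.2 = f x.1` trivially, and this event is `m.prod mΩ`-measurable
exactly because `f` is known under `m`. It lets known factors be frozen at the outer path, with no
integrability condition. -/
theorem ae_ae_condExpKernel_eq_self (hm : m ≤ mΩ) {f : Ω → ℝ} (hf : Measurable[m] f) :
    ∀ᵐ ω ∂P, ∀ᵐ ω' ∂(condExpKernel P m ω), f ω' = f ω := by
  have : MeasurableSet[m.prod mΩ] {x : Ω × Ω | f x.2 = f x.1} := by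
    have h1 : @Measurable (Ω × Ω) ℝ (m.prod mΩ) _ fun x => f x.2 :=
      (hf.mono hm le_rfl).comp (@measurable_snd Ω Ω m mΩ)
    have h2 : @Measurable (Ω × Ω) ℝ (m.prod mΩ) _ fun x => f x.1 :=
      hf.comp (@measurable_fst Ω Ω m mΩ)
    exact measurableSet_eq_fun h1 h2
  exact ae_ae_condExpKernel_diag hm this (ae_of_all _ fun _ => rfl)

theorem setLIntegral_condExpKernel (hm : m ≤ mΩ) {f : Ω → ℝ≥0∞} (hf : Measurable f) {s : Set Ω}
    (hs : MeasurableSet[m] s) :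
    ∫⁻ ω in s, ∫⁻ ω', f ω' ∂(condExpKernel P m ω) ∂P = ∫⁻ ω in s, f ω ∂P := by
  have hg : Measurable[m.prod mΩ] fun x : Ω × Ω => s.indicator 1 x.1 * f x.2 := by
    have h0 : Measurable[m] (s.indicator (1 : Ω → ℝ≥0∞)) :=
      (@measurable_one ℝ≥0∞ Ω _ m _).indicator hs
    have h1 : @Measurable (Ω × Ω) ℝ≥0∞ (m.prod mΩ) _ fun x => s.indicator 1 x.1 :=
      h0.comp (@measurable_fst Ω Ω m mΩ)
    have h2 : @Measurable (Ω × Ω) ℝ≥0∞ (m.prod mΩ) _ fun x => f x.2 :=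
      hf.comp (@measurable_snd Ω Ω m mΩ)
    exact h1.mul h2
  have h := lintegral_condExpKernel_diag (P := P) hm hg
  have e1 : ∀ ω, ∫⁻ ω', s.indicator 1 ω * f ω' ∂(condExpKernel P m ω)
      = s.indicator (fun ω => ∫⁻ ω', f ω' ∂(condExpKernel P m ω)) ω := by
    intro ω
    by_cases hω : ω ∈ s <;> simp [hω]
  have e2 : ∀ ω, s.indicator 1 ω * f ω = s.indicator f ω := by
    intro ω
    by_cases hω : ω ∈ s <;> simp [hω]
  simp only [e1, e2] at h
  rwa [lintegral_indicator (hm _ hs), lintegral_indicator (hm _ hs)] at h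

/-- Uniqueness of conditional expectation: integrals over `m`-measurable sets decide, and with
values in `[0, ∞]` no integrability is needed. -/
theorem condExpKernel_lintegral_ae_eq (hm : m ≤ mΩ) {f g : Ω → ℝ≥0∞} (hf : Measurable f)
    (hg : Measurable[m] g)
    (h : ∀ s, MeasurableSet[m] s → ∫⁻ ω in s, f ω ∂P = ∫⁻ ω in s, g ω ∂P) :
    ∀ᵐ ω ∂P, ∫⁻ ω', f ω' ∂(condExpKernel P m ω) = g ω := by
  refine ae_of_ae_trim hm ?_
  have := @ae_eq_of_forall_setLIntegral_eq_of_sigmaFinite Ω m (P.trim hm) _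
    (fun ω => ∫⁻ ω', f ω' ∂(condExpKernel P m ω)) g (measurable_lintegral_condExpKernel hf) hg ?_
  · exact this
  · intro s hs _
    rw [restrict_trim hm _ hs, lintegral_trim hm (measurable_lintegral_condExpKernel hf),
      lintegral_trim hm hg, setLIntegral_condExpKernel hm hf hs, h s hs]

/-- An independent factor can be integrated out. -/
theorem lintegral_condExpKernel_mul_indep (hmm : m ≤ m') (hm' : m' ≤ mΩ) {Z : Ω → ℝ}
    (hZ : Measurable Z) (hind : Indep (MeasurableSpace.comap Z inferInstance) m' P)
    {f : Ω → ℝ≥0∞} (hf : Measurable[m'] f) {φ : ℝ → ℝ≥0∞} (hφ : Measurable φ) :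
    ∀ᵐ ω ∂P, ∫⁻ ω', f ω' * φ (Z ω') ∂(condExpKernel P m ω)
      = (∫⁻ ω', f ω' ∂(condExpKernel P m ω)) * ∫⁻ ω', φ (Z ω') ∂P := by
  have hfΩ : Measurable f := hf.mono hm' le_rfl
  refine condExpKernel_lintegral_ae_eq (hmm.trans hm') (hfΩ.mul (hφ.comp hZ))
    ((measurable_lintegral_condExpKernel hfΩ).mul_const _) fun s hs => ?_
  rw [lintegral_mul_const _
    ((measurable_lintegral_condExpKernel hfΩ).mono (hmm.trans hm') le_rfl),
    setLIntegral_condExpKernel (hmm.trans hm') hfΩ hs]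
  have hs' := (hmm.trans hm') _ hs
  have e : ∀ ω, s.indicator (fun ω => f ω * φ (Z ω)) ω = s.indicator f ω * φ (Z ω) := by
    intro ω
    by_cases hω : ω ∈ s <;> simp [hω]
  rw [← lintegral_indicator hs', ← lintegral_indicator hs']
  simp only [e]
  exact lintegral_mul_eq_lintegral_mul_lintegral_of_independent_measurableSpace hm'
    hZ.comap_le hind.symm (hf.indicator (hmm _ hs))
    (hφ.comp (comap_measurable Z))

/-- Independence gives each interval its unconditional mass off a null set. Rational intervals are
countably many, so one null set serves all of them, and they determine the law. -/
theorem map_condExpKernel_of_indep (hm : m ≤ mΩ) [IsProbabilityMeasure P] {Z : Ω → ℝ}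
    (hZ : Measurable Z) (hind : Indep (MeasurableSpace.comap Z inferInstance) m P) :
    ∀ᵐ ω ∂P, (condExpKernel P m ω).map Z = P.map Z := by
  have key : ∀ a b : ℚ, ∀ᵐ ω ∂P, (condExpKernel P m ω).map Z (Set.Ioo (a : ℝ) b)
      = P.map Z (Set.Ioo (a : ℝ) b) := by
    intro a b
    have h := lintegral_condExpKernel_mul_indep le_rfl hm hZ hind (f := fun _ => 1)
      measurable_const (φ := (Set.Ioo (a : ℝ) b).indicator 1)
      (measurable_one.indicator measurableSet_Ioo)
    filter_upwards [h] with ω hω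
    simp only [one_mul, lintegral_one, measure_univ] at hω
    rw [← lintegral_indicator_one measurableSet_Ioo, lintegral_map
      (measurable_one.indicator measurableSet_Ioo) hZ, hω, ← lintegral_map
      (measurable_one.indicator measurableSet_Ioo) hZ]
    rw [lintegral_indicator_one measurableSet_Ioo]
  filter_upwards [ae_all_iff.2 fun a => ae_all_iff.2 (key a)] with ω hω
  have := Measure.isProbabilityMeasure_map (μ := condExpKernel P m ω) hZ.aemeasurable
  exact Real.measure_ext_Ioo_rat hω

end Kernel

/-! ### Utility functions and expected gain-loss against an atomless law -/

namespace Params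

variable (a : Params)

theorem measurable_m : Measurable a.m := by
  unfold Params.m
  by_cases h : a.θ = 1
  · simpa [h] using Real.measurable_log
  · simp only [h, if_false]
    fun_prop

theorem measurable_mu : Measurable a.mu := by
  unfold Params.mu
  exact Measurable.ite measurableSet_Ici measurable_id (measurable_id.const_mul _)

theorem hasDerivAt_m {c : ℝ} (hc : 0 < c) : HasDerivAt a.m (c ^ (-a.θ)) c := by
  unfold Params.m
  by_cases h : a.θ = 1
  · simp only [h, if_true, Real.rpow_neg_one]
    exact Real.hasDerivAt_log hc.ne'
  · simp only [h, if_false]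
    have h1 : 1 - a.θ ≠ 0 := sub_ne_zero.2 (Ne.symm h)
    have := (Real.hasDerivAt_rpow_const (p := 1 - a.θ) (Or.inl hc.ne')).div_const (1 - a.θ)
    rw [mul_div_cancel_left₀ _ h1, show 1 - a.θ - 1 = -a.θ by ring] at this
    exact this

theorem strictMonoOn_m : StrictMonoOn a.m (Set.Ioi 0) := by
  refine strictMonoOn_of_deriv_pos (convex_Ioi 0)
    (fun x hx => (a.hasDerivAt_m hx).continuousAt.continuousWithinAt) fun x hx => ?_
  rw [interior_Ioi] at hx
  rw [(a.hasDerivAt_m hx).deriv]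
  exact Real.rpow_pos_of_pos hx _

/-- Mean value inequality on `[c/2, ∞)`, where the slope `z^(-θ)` is at most `(c/2)^(-θ)`. -/
theorem abs_m_sub_m_le {c x y : ℝ} (hc : 0 < c) (hx : c / 2 ≤ x) (hy : c / 2 ≤ y) :
    |a.m x - a.m y| ≤ 2 ^ a.θ * c ^ (-a.θ) * |x - y| := by
  have h := (convex_Ici (c / 2)).norm_image_sub_le_of_norm_hasDerivWithin_le (f := a.m)
    (f' := fun z => z ^ (-a.θ)) (C := (c / 2) ^ (-a.θ))
    (fun z hz => (a.hasDerivAt_m (lt_of_lt_of_le (half_pos hc) hz)).hasDerivWithinAt)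
    (fun z hz => ?_) hy hx
  · rw [Real.norm_eq_abs, Real.norm_eq_abs, Real.div_rpow hc.le zero_le_two,
      Real.rpow_neg zero_le_two, div_inv_eq_mul, mul_comm (c ^ (-a.θ))] at h
    exact h
  · have hz0 : 0 < z := lt_of_lt_of_le (half_pos hc) hz
    rw [Real.norm_of_nonneg (Real.rpow_nonneg hz0.le _)]
    exact Real.rpow_le_rpow_of_nonpos (half_pos hc) hz (by linarith [a.θ_pos])

theorem lam_pos : 0 < a.lam := lt_of_lt_of_le one_pos a.one_le_lam

theorem abs_mu_sub_mu_le (x y : ℝ) : |a.mu x - a.mu y| ≤ a.lam * |x - y| := by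
  have hl := a.one_le_lam
  unfold Params.mu
  split_ifs with h1 h2 h2
  · nlinarith [abs_nonneg (x - y)]
  · push Not at h2
    rw [abs_of_nonneg (by nlinarith), abs_of_nonneg (by linarith)]
    nlinarith
  · push Not at h1
    rw [abs_of_nonpos (by nlinarith), abs_of_nonpos (by linarith)]
    nlinarith
  · rw [← mul_sub, abs_mul, abs_of_pos a.lam_pos]

theorem mu_zero : a.mu 0 = 0 := by simp [Params.mu]

theorem abs_mu_le (x : ℝ) : |a.mu x| ≤ a.lam * |x| := by
  simpa [a.mu_zero] using a.abs_mu_sub_mu_le x 0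

/-- Because `m` is increasing, the sign of `m x - m d` is constant near any `c ≠ d`, so only one
linear branch of `μ` is seen. -/
theorem hasDerivAt_mu_m {c d : ℝ} (hc : 0 < c) (hd : 0 < d) (hcd : d ≠ c) :
    HasDerivAt (fun x => a.mu (a.m x - a.m d)) ((if d < c then 1 else a.lam) * c ^ (-a.θ)) c := by
  have h0 := (a.hasDerivAt_m hc).sub_const (a.m d)
  rcases lt_or_gt_of_ne hcd with h | h
  · rw [if_pos h, one_mul]
    refine h0.congr_of_eventuallyEq ?_
    filter_upwards [Ioi_mem_nhds h] with x hx
    have := a.strictMonoOn_m hd (Set.mem_Ioi.2 (hd.trans hx)) hx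
    rw [Params.mu, if_pos (by linarith)]
  · rw [if_neg h.not_gt]
    refine (h0.const_mul a.lam).congr_of_eventuallyEq ?_
    filter_upwards [Iio_mem_nhds h, Ioi_mem_nhds hc] with x hx hx0
    have := a.strictMonoOn_m hx0 hd hx
    rw [Params.mu, if_neg (by linarith)]

/-- Scaling shifts logarithmic utility and multiplies power utility; either way integrability passes
from `m e` to `m (k * e)`. -/
theorem m_mul {k e : ℝ} (hk : 0 < k) (he : 0 < e) :
    a.m (k * e) = if a.θ = 1 then Real.log k + a.m e else k ^ (1 - a.θ) * a.m e := by
  unfold Params.m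
  split_ifs
  · rw [Real.log_mul hk.ne' he.ne']
  · rw [Real.mul_rpow hk.le he.le, mul_div_assoc]

/-- Expected gain-loss utility of consuming `c` when the reference point is `k` times a draw from
the law `ν`. -/
noncomputable def gainLoss (ν : Measure ℝ) (c k : ℝ) : ℝ := ∫ e, a.mu (a.m c - a.m (k * e)) ∂ν

section GainLoss

variable {ν : Measure ℝ}

theorem measurable_gainLoss [SFinite ν] : Measurable fun x : ℝ × ℝ => a.gainLoss ν x.1 x.2 := by
  have : Measurable fun z : (ℝ × ℝ) × ℝ => a.mu (a.m z.1.1 - a.m (z.1.2 * z.2)) :=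
    a.measurable_mu.comp ((a.measurable_m.comp (by fun_prop)).sub
      (a.measurable_m.comp (by fun_prop)))
  exact this.stronglyMeasurable.integral_prod_right'.measurable

theorem measurable_gainLoss_integrand (c k : ℝ) :
    Measurable fun e => a.mu (a.m c - a.m (k * e)) :=
  a.measurable_mu.comp (measurable_const.sub (a.measurable_m.comp (measurable_const_mul k)))

theorem integrable_gainLoss [IsFiniteMeasure ν] (hν : ∀ᵐ e ∂ν, 0 < e) (hm : Integrable a.m ν)
    (c : ℝ) {k : ℝ} (hk : 0 < k) : Integrable (fun e => a.mu (a.m c - a.m (k * e))) ν := by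
  have h1 : Integrable (fun e => a.m (k * e)) ν := by
    by_cases h : a.θ = 1
    · refine ((integrable_const (Real.log k)).add hm).congr ?_
      filter_upwards [hν] with e he
      simp [a.m_mul hk he, h]
    · refine (hm.const_mul (k ^ (1 - a.θ))).congr ?_
      filter_upwards [hν] with e he
      simp [a.m_mul hk he, h]
  have h2 := (((integrable_const (a.m c)).sub h1).norm).const_mul a.lam
  exact h2.mono' (a.measurable_gainLoss_integrand c k).aestronglyMeasurable
    (ae_of_all _ fun e => a.abs_mu_le _)

theorem abs_gainLoss_sub_le [IsProbabilityMeasure ν] (hν : ∀ᵐ e ∂ν, 0 < e)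
    (hm : Integrable a.m ν) (c c' : ℝ) {k : ℝ} (hk : 0 < k) :
    |a.gainLoss ν c k - a.gainLoss ν c' k| ≤ a.lam * |a.m c - a.m c'| := by
  rw [gainLoss, gainLoss, ← integral_sub (a.integrable_gainLoss hν hm c hk)
    (a.integrable_gainLoss hν hm c' hk)]
  have h : ∀ᵐ e ∂ν, ‖a.mu (a.m c - a.m (k * e)) - a.mu (a.m c' - a.m (k * e))‖
      ≤ a.lam * |a.m c - a.m c'| := ae_of_all _ fun e => ?_
  · simpa using norm_integral_le_of_norm_le_const h
  refine (a.abs_mu_sub_mu_le _ _).trans (le_of_eq ?_)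
  congr 2
  ring

/-- The integrand is differentiable at `c` unless `k e = c`, which has probability zero. Draws below
`c / k` are gains with slope `1`, the others losses with slope `lam`. The Lipschitz bounds of `μ`
and `m` give a constant dominating function. -/
theorem hasDerivAt_gainLoss [IsProbabilityMeasure ν] (hν : ∀ᵐ e ∂ν, 0 < e)
    (hm : Integrable a.m ν) (hatom : ∀ x : ℝ, ν {x} = 0) {c k : ℝ} (hc : 0 < c) (hk : 0 < k) :
    HasDerivAt (fun x => a.gainLoss ν x k)
      (c ^ (-a.θ) * (cdf ν (c / k) + a.lam * (1 - cdf ν (c / k)))) c := by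
  have hne : ∀ᵐ e ∂ν, e ≠ c / k := by
    rw [ae_iff]
    simpa using hatom (c / k)
  -- Rewritten as a constant plus a multiple of an indicator of `Iic`, the slope integrates to the
  -- cdf; passing from `<` to `≤` costs only the null point `c / k`.
  have hF' : (fun e => (if k * e < c then 1 else a.lam) * c ^ (-a.θ)) =ᵐ[ν]
      fun e => (Set.Iic (c / k)).indicator (fun _ => (1 - a.lam) * c ^ (-a.θ)) e
        + a.lam * c ^ (-a.θ) := by
    filter_upwards [hne] with e he
    by_cases h : e ≤ c / k
    · have h' : k * e < c := by
        rw [mul_comm, ← lt_div_iff₀ hk]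
        exact lt_of_le_of_ne h he
      simp [h, h']
      ring
    · have h' : ¬ k * e < c := by
        rw [mul_comm, ← lt_div_iff₀ hk]
        exact fun h'' => h h''.le
      simp [h, h']
  have h := hasDerivAt_integral_of_dominated_loc_of_lip (μ := ν) (x₀ := c)
    (F := fun x e => a.mu (a.m x - a.m (k * e)))
    (F' := fun e => (if k * e < c then 1 else a.lam) * c ^ (-a.θ))
    (bound := fun _ => a.lam * (2 ^ a.θ * c ^ (-a.θ))) (s := Set.Ioi (c / 2))
    (Ioi_mem_nhds (by linarith))
    (Filter.Eventually.of_forall fun x => (a.integrable_gainLoss hν hm x hk).aestronglyMeasurable)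
    (a.integrable_gainLoss hν hm c hk) ?_ ?_ (integrable_const _) ?_
  · have h2 := h.2
    rw [integral_congr_ae hF', integral_add ((integrable_const _).indicator measurableSet_Iic)
      (integrable_const _), integral_indicator measurableSet_Iic] at h2
    refine h2.congr_deriv ?_
    simp only [cdf_eq_real, integral_const, smul_eq_mul, measureReal_restrict_apply_univ,
      probReal_univ]
    ring
  · refine Measurable.aestronglyMeasurable (Measurable.mul_const (Measurable.ite ?_ ?_ ?_) _)
    · exact measurableSet_lt (by fun_prop) (by fun_prop)
    · fun_prop
    · fun_prop
  · refine ae_of_all _ fun e => LipschitzOnWith.of_dist_le_mul fun x hx y hy => ?_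
    have hb : 0 ≤ a.lam * (2 ^ a.θ * c ^ (-a.θ)) := mul_nonneg a.lam_pos.le (by positivity)
    rw [Real.dist_eq, Real.dist_eq, Real.coe_nnabs, abs_of_nonneg hb]
    refine (a.abs_mu_sub_mu_le _ _).trans ?_
    rw [mul_assoc]
    refine mul_le_mul_of_nonneg_left ?_ a.lam_pos.le
    have := a.abs_m_sub_m_le hc (Set.mem_Ioi.1 hx).le (Set.mem_Ioi.1 hy).le
    rwa [sub_sub_sub_cancel_right]
  · filter_upwards [hν, hne] with e he hek
    refine a.hasDerivAt_mu_m hc (mul_pos hk he) ?_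
    rw [Ne, mul_comm, ← eq_div_iff hk.ne']
    exact hek

theorem integrable_rpow_of_integrable_m [IsFiniteMeasure ν] (hm : Integrable a.m ν) :
    Integrable (fun e => e ^ (1 - a.θ)) ν := by
  by_cases h : a.θ = 1
  · simp [h]
  · refine (hm.const_mul (1 - a.θ)).congr (ae_of_all _ fun e => ?_)
    simp only [Params.m, h, if_false]
    exact mul_div_cancel₀ _ (sub_ne_zero.2 (Ne.symm h))

end GainLoss

end Params

/-! ### Information and moments of consumption growth -/

namespace Market

section Info

variable {Ω : Type*} {X : Market Ω}

theorem info_mono {s t : ℕ} (h : s ≤ t) : X.info s ≤ X.info t :=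
  biSup_mono fun _ hi => le_trans (Set.mem_Iic.1 hi) h

theorem measurable_info_prod {s t : ℕ} (h : s ≤ t) :
    Measurable[X.info t] fun ω => (X.Cbar s ω, X.D s ω) :=
  (comap_measurable _).mono (le_biSup (fun s => MeasurableSpace.comap
    (fun ω => (X.Cbar s ω, X.D s ω)) inferInstance) (Set.mem_Iic.2 h)) le_rfl

theorem measurable_info_Cbar {s t : ℕ} (h : s ≤ t) : Measurable[X.info t] (X.Cbar s) :=
  measurable_fst.comp (measurable_info_prod h)

theorem measurable_info_D {s t : ℕ} (h : s ≤ t) : Measurable[X.info t] (X.D s) :=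
  measurable_snd.comp (measurable_info_prod h)

theorem measurable_info_growth {s t : ℕ} (h : s ≤ t) : Measurable[X.info t] (X.growth s) :=
  (measurable_info_Cbar h).div (measurable_info_Cbar ((Nat.sub_le s 1).trans h))

end Info

end Market

variable {Ω : Type*} [MeasurableSpace Ω]

namespace Market

variable {X : Market Ω} {P : Measure Ω}

namespace Standing

theorem info_le (hX : X.Standing P) (t : ℕ) : X.info t ≤ ‹MeasurableSpace Ω› :=
  iSup₂_le fun s _ => ((hX.measurable_Cbar s).prodMk (hX.measurable_D s)).comap_le

theorem measurable_growth (hX : X.Standing P) (t : ℕ) : Measurable (X.growth t) :=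
  (measurable_info_growth le_rfl).mono (hX.info_le t) le_rfl

theorem measurable_S' (hX : X.Standing P) (t : ℕ) : Measurable (X.S t) :=
  (hX.measurable_S t).mono (hX.info_le t) le_rfl

theorem growth_pos (hX : X.Standing P) (t : ℕ) (ω : Ω) : 0 < X.growth t ω :=
  div_pos (hX.Cbar_pos _ _) (hX.Cbar_pos _ _)

theorem RS_pos (hX : X.Standing P) (t : ℕ) (ω : Ω) : 0 < X.RS t ω :=
  div_pos (add_pos (hX.S_pos _ _) (hX.D_pos _ _)) (hX.S_pos _ _)

theorem ratio_pos (hX : X.Standing P) (t : ℕ) (ω : Ω) : 0 < X.ratio t ω :=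
  div_pos (hX.Cbar_pos _ _) (hX.D_pos _ _)

theorem ae_pos (hX : X.Standing P) : ∀ᵐ e ∂(P.map (X.growth 1)), 0 < e :=
  (ae_map_iff (hX.measurable_growth 1).aemeasurable measurableSet_Ioi).2
    (ae_of_all _ (hX.growth_pos 1))

theorem integrable_m_map (hX : X.Standing P) {a : Params}
    (hm : Integrable (fun ω => a.m (X.growth 1 ω)) P) : Integrable a.m (P.map (X.growth 1)) :=
  (integrable_map_measure a.measurable_m.aestronglyMeasurable
    (hX.measurable_growth 1).aemeasurable).2 hm

theorem integrable_growth_rpow (hX : X.Standing P) [IsFiniteMeasure P] {a : Params}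
    (hm : Integrable (fun ω => a.m (X.growth 1 ω)) P) :
    Integrable (fun ω => X.growth 1 ω ^ (1 - a.θ)) P :=
  (a.integrable_rpow_of_integrable_m (hX.integrable_m_map hm)).comp_measurable
    (hX.measurable_growth 1)

theorem lintegral_growth_rpow (hX : X.Standing P) [IsFiniteMeasure P] {a : Params}
    (hm : Integrable (fun ω => a.m (X.growth 1 ω)) P) (t : ℕ) :
    ∫⁻ ω, ENNReal.ofReal (X.growth (t + 1) ω ^ (1 - a.θ)) ∂P
      = ENNReal.ofReal (∫ ω, X.growth 1 ω ^ (1 - a.θ) ∂P) := by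
  have hmeas : Measurable fun e : ℝ => ENNReal.ofReal (e ^ (1 - a.θ)) := by fun_prop
  rw [← lintegral_map hmeas (hX.measurable_growth (t + 1)), hX.growth_law t,
    lintegral_map hmeas (hX.measurable_growth 1),
    ofReal_integral_eq_lintegral_ofReal (hX.integrable_growth_rpow hm)
      (ae_of_all _ fun ω => Real.rpow_nonneg (hX.growth_pos 1 ω).le _)]

theorem integral_growth_rpow_nonneg (hX : X.Standing P) (a : Params) :
    0 ≤ ∫ ω, X.growth 1 ω ^ (1 - a.θ) ∂P :=
  integral_nonneg fun ω => Real.rpow_nonneg (hX.growth_pos 1 ω).le _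

variable [StandardBorelSpace Ω]

theorem map_growth_condExpKernel (hX : X.Standing P) [IsProbabilityMeasure P] (t : ℕ) :
    ∀ᵐ ω ∂P, (condExpKernel P (X.info t) ω).map (X.growth (t + 1)) = P.map (X.growth 1) := by
  filter_upwards [map_condExpKernel_of_indep (hX.info_le t) (hX.measurable_growth (t + 1))
    (hX.growth_indep t)] with ω hω
  rw [hω, hX.growth_law t]

theorem ae_ae (hX : X.Standing P) [IsFiniteMeasure P] (t : ℕ) {q : Ω → Prop}
    (hq : ∀ᵐ ω ∂P, q ω) : ∀ᵐ ω ∂P, ∀ᵐ ω' ∂(condExpKernel P (X.info t) ω), q ω' :=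
  ae_ae_condExpKernel (hX.info_le t) hq

theorem ae_ae_eq_self (hX : X.Standing P) [IsFiniteMeasure P] (t : ℕ) {f : Ω → ℝ}
    (hf : Measurable[X.info t] f) :
    ∀ᵐ ω ∂P, ∀ᵐ ω' ∂(condExpKernel P (X.info t) ω), f ω' = f ω :=
  ae_ae_condExpKernel_eq_self (hX.info_le t) hf

/-- Consumption growth over `j` periods, raised to `1 - θ`, can be integrated out. -/
theorem lintegral_mul_growth (hX : X.Standing P) [IsProbabilityMeasure P] {a : Params}
    (hm : Integrable (fun ω => a.m (X.growth 1 ω)) P) {t u : ℕ} (htu : t ≤ u)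
    {f : Ω → ℝ≥0∞} (hf : Measurable[X.info u] f) (j : ℕ) :
    ∀ᵐ ω ∂P, ∫⁻ ω', f ω' * ENNReal.ofReal ((X.Cbar (u + j) ω' / X.Cbar u ω') ^ (1 - a.θ))
        ∂(condExpKernel P (X.info t) ω)
      = (∫⁻ ω', f ω' ∂(condExpKernel P (X.info t) ω))
        * ENNReal.ofReal (∫ ω, X.growth 1 ω ^ (1 - a.θ) ∂P) ^ j := by
  induction j with
  | zero =>
    refine ae_of_all _ fun ω => ?_
    simp [(hX.Cbar_pos _ _).ne']
  | succ j ih =>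
    have hr : Measurable[X.info (u + j)]
        fun ω => f ω * ENNReal.ofReal ((X.Cbar (u + j) ω / X.Cbar u ω) ^ (1 - a.θ)) :=
      (hf.mono (info_mono (Nat.le_add_right u j)) le_rfl).mul
        (ENNReal.measurable_ofReal.comp (((measurable_info_Cbar le_rfl).div
          (measurable_info_Cbar (Nat.le_add_right u j))).pow_const _))
    have h := lintegral_condExpKernel_mul_indep
      (info_mono (htu.trans (Nat.le_add_right u j))) (hX.info_le (u + j))
      (hX.measurable_growth (u + j + 1)) (hX.growth_indep (u + j)) hr
      (φ := fun e => ENNReal.ofReal (e ^ (1 - a.θ))) (by fun_prop)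
    filter_upwards [ih, h] with ω h1 h2
    rw [h1, hX.lintegral_growth_rpow hm, mul_assoc, ← pow_succ] at h2
    rw [← h2]
    refine lintegral_congr fun ω' => ?_
    have p1 := hX.Cbar_pos u ω'
    have p2 := hX.Cbar_pos (u + j) ω'
    have p3 := hX.Cbar_pos (u + j + 1) ω'
    rw [mul_assoc, ← ENNReal.ofReal_mul (by positivity), growth,
      ← Real.mul_rpow (by positivity) (by simp only [Nat.add_sub_cancel]; positivity)]
    congr 3
    simp only [Nat.add_sub_cancel]
    rw [mul_comm, div_mul_div_cancel₀ p2.ne', add_assoc]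

/-- Both integrals are `toReal` of lower integrals of nonnegative functions, so the identity needs
no integrability of `f`. -/
theorem integral_mul_growth (hX : X.Standing P) [IsProbabilityMeasure P] {a : Params}
    (hm : Integrable (fun ω => a.m (X.growth 1 ω)) P) {t u : ℕ} (htu : t ≤ u)
    {f : Ω → ℝ} (hf : Measurable[X.info u] f) (hf0 : ∀ ω, 0 ≤ f ω) (j : ℕ) :
    ∀ᵐ ω ∂P, ∫ ω', f ω' * (X.Cbar (u + j) ω' / X.Cbar u ω') ^ (1 - a.θ)
        ∂(condExpKernel P (X.info t) ω)
      = (∫ ω', f ω' ∂(condExpKernel P (X.info t) ω))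
        * (∫ ω, X.growth 1 ω ^ (1 - a.θ) ∂P) ^ j := by
  filter_upwards [hX.lintegral_mul_growth hm htu (ENNReal.measurable_ofReal.comp hf) j] with ω hω
  have hfm := hf.mono (hX.info_le u) le_rfl
  have hr : ∀ ω', 0 ≤ (X.Cbar (u + j) ω' / X.Cbar u ω') ^ (1 - a.θ) := fun ω' =>
    Real.rpow_nonneg (div_nonneg (hX.Cbar_pos _ _).le (hX.Cbar_pos _ _).le) _
  rw [integral_eq_lintegral_of_nonneg_ae (ae_of_all _ hf0) hfm.aestronglyMeasurable,
    integral_eq_lintegral_of_nonneg_ae (ae_of_all _ fun ω' => mul_nonneg (hf0 ω') (hr ω'))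
      (hfm.mul (((hX.measurable_Cbar _).div
        (hX.measurable_Cbar _)).pow_const _)).aestronglyMeasurable]
  simp only [Function.comp_apply, ← ENNReal.ofReal_mul (hf0 _)] at hω
  rw [hω, ENNReal.toReal_mul, ENNReal.toReal_pow,
    ENNReal.toReal_ofReal (hX.integral_growth_rpow_nonneg a)]

end Standing

end Market

/-! ### Equilibrium wealth and closed forms of utility -/

section ClosedForms

variable [StandardBorelSpace Ω] {P : Measure Ω} [IsProbabilityMeasure P] {X : Market Ω}
  {a : Params} {p : Plan Ω}

/-- Savings `W - C` equal the price of one share, which pays `S + D` at the next date; labor income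
`C̄ - D` then replaces the dividend by consumption. -/
theorem IsEquilibrium.wealth (heq : IsEquilibrium a P X p) (hX : X.Standing P) (t : ℕ) (ω : Ω) :
    p.W t ω = X.S t ω + X.Cbar t ω := by
  induction t with
  | zero => rw [heq.feasible.initial, Market.labor]; ring
  | succ t ih =>
    rw [heq.feasible.budget, ih, heq.clearing_endowment, heq.clearing_stock, Market.labor,
      Market.RS, Nat.add_sub_cancel]
    have := (hX.S_pos t ω).ne'
    field_simp
    ring

theorem IsEquilibrium.wealth_pos (heq : IsEquilibrium a P X p) (hX : X.Standing P) (t : ℕ)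
    (ω : Ω) : 0 < p.W t ω := by
  rw [heq.wealth hX]
  exact add_pos (hX.S_pos _ _) (hX.Cbar_pos _ _)

theorem IsEquilibrium.measurable_W (heq : IsEquilibrium a P X p) (hX : X.Standing P) (t : ℕ) :
    Measurable[X.info t] (p.W t) := by
  rw [show p.W t = fun ω => X.S t ω + X.Cbar t ω from funext (heq.wealth hX t)]
  exact (hX.measurable_S t).add (Market.measurable_info_Cbar le_rfl)

/-- The wealth growth factors telescope, and the terminal wealth cancels against the propensity to
consume. -/
theorem chat_eq (heq : IsEquilibrium a P X p) (hX : X.Standing P) (t i : ℕ) (w : ℝ) (ω : Ω) :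
    Chat p t (i + 1) w ω = X.Cbar (t + (i + 1)) ω / p.W (t + 1) ω * w := by
  have hprod : ∏ j ∈ Finset.Icc 2 (i + 1), p.W (t + j) ω / p.W (t + j - 1) ω
      = p.W (t + (i + 1)) ω / p.W (t + 1) ω := by
    induction i with
    | zero => simp [(heq.wealth_pos hX (t + 1) ω).ne']
    | succ i ih =>
      rw [Finset.prod_Icc_succ_top (by omega), ih]
      have h1 := (heq.wealth_pos hX (t + 1) ω).ne'
      have h2 := (heq.wealth_pos hX (t + (i + 1)) ω).ne'
      rw [show t + (i + 1 + 1) - 1 = t + (i + 1) by omega]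
      field_simp
  rw [Chat, hprod, heq.clearing_endowment]
  have h1 := (heq.wealth_pos hX (t + 1) ω).ne'
  have h2 := (heq.wealth_pos hX (t + (i + 1)) ω).ne'
  field_simp

/-- Closed form of utility from consumption. -/
theorem U_eq_gainLoss (heq : IsEquilibrium a P X p) (hX : X.Standing P) (t : ℕ) :
    ∀ᵐ ω ∂P, ∀ c, U a P X p (t + 1) c ω
      = a.m c + a.b * a.gainLoss (P.map (X.growth 1)) c (X.Cbar t ω) := by
  filter_upwards [hX.map_growth_condExpKernel t,
    hX.ae_ae_eq_self t (Market.measurable_info_Cbar le_rfl)] with ω h1 h2 c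
  rw [U, Params.gainLoss, ← h1, integral_map (hX.measurable_growth _).aemeasurable
    (a.measurable_gainLoss_integrand _ _).aestronglyMeasurable, condE, Nat.add_sub_cancel]
  congr 2
  refine integral_congr_ae ?_
  -- Consumption at `t` is known at `t`, so under the kernel the reference point is the outer
  -- `X.Cbar t ω` times a fresh growth draw.
  filter_upwards [h2] with ω' h3
  rw [heq.clearing_endowment, ← h3, Market.growth, Nat.add_sub_cancel,
    mul_div_cancel₀ _ (hX.Cbar_pos t ω').ne']

/-- Closed form of prospective gain-loss utility. -/
theorem prosp_eq_gainLoss (heq : IsEquilibrium a P X p) (hX : X.Standing P) (t : ℕ) :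
    ∀ᵐ ω ∂P, ∀ (i : ℕ) (w : ℝ), prosp a P X p (t + 1) (i + 1) w ω
      = a.gainLoss (P.map (X.growth 1)) (X.Cbar (t + 1 + (i + 1)) ω / p.W (t + 2) ω * w)
        (X.Cbar t ω * (X.Cbar (t + 1 + (i + 1)) ω / X.Cbar (t + 1) ω)) := by
  filter_upwards [hX.map_growth_condExpKernel t] with ω h1 i w
  rw [prosp, Params.gainLoss, ← h1, integral_map (hX.measurable_growth _).aemeasurable
    (a.measurable_gainLoss_integrand _ _).aestronglyMeasurable, condE, Nat.add_sub_cancel]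
  refine integral_congr_ae (ae_of_all _ fun ω' => ?_)
  simp only [prospAt, chat_eq heq hX, CrefHat, heq.clearing_endowment, Nat.add_sub_cancel,
    Market.growth]
  congr 3
  ring

end ClosedForms

section Weights

variable {P : Measure Ω} {X : Market Ω} {a : Params}

theorem measurable_F : Measurable (F P X) :=
  (monotone_cdf _).measurable

theorem F_nonneg (x : ℝ) : 0 ≤ F P X x := cdf_nonneg _ x

theorem F_le_one (x : ℝ) : F P X x ≤ 1 := cdf_le_one _ x

theorem Φ_nonneg (x : ℝ) : 0 ≤ Φ a P X x :=
  add_nonneg (F_nonneg x) (mul_nonneg a.lam_pos.le (sub_nonneg.2 (F_le_one x)))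

theorem measurable_Φ : Measurable (Φ a P X) :=
  measurable_F.add ((measurable_const.sub measurable_F).const_mul _)

theorem G_eq (x : ℝ) : G a P X x = 1 + a.b * Φ a P X x := by
  rw [G, Φ]; ring

theorem measurable_G : Measurable (G a P X) := by
  rw [show G a P X = fun x => 1 + a.b * Φ a P X x from funext G_eq]
  exact measurable_const.add (measurable_Φ.const_mul _)

theorem G_pos (x : ℝ) : 0 < G a P X x := by
  rw [G_eq]
  have := mul_nonneg a.b_nonneg (Φ_nonneg (a := a) (P := P) (X := X) x)
  linarith

end Weights

/-! ### Marginal utilities at the equilibrium plan -/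

section Derivatives

variable [StandardBorelSpace Ω] {P : Measure Ω} [IsProbabilityMeasure P] {X : Market Ω}
  {a : Params} {p : Plan Ω}

theorem hasDerivAt_U (heq : IsEquilibrium a P X p) (hX : X.Standing P)
    (hatom : ∀ x : ℝ, P.map (X.growth 1) {x} = 0)
    (hm : Integrable (fun ω => a.m (X.growth 1 ω)) P) (t : ℕ) :
    ∀ᵐ ω ∂P, HasDerivAt (fun c => U a P X p (t + 1) c ω)
      (X.Cbar (t + 1) ω ^ (-a.θ) * G a P X (X.growth (t + 1) ω)) (X.Cbar (t + 1) ω) := by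
  have := Measure.isProbabilityMeasure_map (μ := P) (hX.measurable_growth 1).aemeasurable
  filter_upwards [U_eq_gainLoss heq hX t] with ω h1
  rw [show (fun c => U a P X p (t + 1) c ω) = _ from funext h1]
  have hc := hX.Cbar_pos (t + 1) ω
  refine ((a.hasDerivAt_m hc).add ((a.hasDerivAt_gainLoss hX.ae_pos (hX.integrable_m_map hm)
    hatom hc (hX.Cbar_pos t ω)).const_mul a.b)).congr_deriv ?_
  rw [G_eq, Φ, F, Market.growth, Nat.add_sub_cancel]
  ring

/-- Consumption at the horizon scales both the forecast and the reference point, so their ratio is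
the growth rate at `t + 1` whatever `i` is. Hence one weight `Φ` serves all horizons. Linearity of
the forecast in wealth turns `C̄^(-θ)` into `C̄^(1-θ) / W`. -/
theorem hasDerivAt_prosp (heq : IsEquilibrium a P X p) (hX : X.Standing P)
    (hatom : ∀ x : ℝ, P.map (X.growth 1) {x} = 0)
    (hm : Integrable (fun ω => a.m (X.growth 1 ω)) P) (t : ℕ) :
    ∀ᵐ ω ∂P, ∀ i : ℕ, HasDerivAt (fun w => prosp a P X p (t + 1) (i + 1) w ω)
      (Φ a P X (X.growth (t + 1) ω) * X.Cbar (t + 2) ω ^ (1 - a.θ) / p.W (t + 2) ω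
        * (X.Cbar (t + 2 + i) ω / X.Cbar (t + 2) ω) ^ (1 - a.θ)) (p.W (t + 2) ω) := by
  have := Measure.isProbabilityMeasure_map (μ := P) (hX.measurable_growth 1).aemeasurable
  filter_upwards [prosp_eq_gainLoss heq hX t] with ω h1 i
  rw [show (fun w => prosp a P X p (t + 1) (i + 1) w ω) = _ from funext (h1 i)]
  have hc := hX.Cbar_pos t ω
  have hc1 := hX.Cbar_pos (t + 1) ω
  have hc2 := hX.Cbar_pos (t + 2) ω
  have hci := hX.Cbar_pos (t + 1 + (i + 1)) ω
  have hW := heq.wealth_pos hX (t + 2) ω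
  have e1 : X.Cbar (t + 1 + (i + 1)) ω / p.W (t + 2) ω * p.W (t + 2) ω
      = X.Cbar (t + 1 + (i + 1)) ω := div_mul_cancel₀ _ hW.ne'
  have hk : 0 < X.Cbar t ω * (X.Cbar (t + 1 + (i + 1)) ω / X.Cbar (t + 1) ω) := by positivity
  have h2 := a.hasDerivAt_gainLoss hX.ae_pos (hX.integrable_m_map hm) hatom hci hk
  refine (h2.comp_of_eq (p.W (t + 2) ω) ((hasDerivAt_id _).const_mul
    (X.Cbar (t + 1 + (i + 1)) ω / p.W (t + 2) ω)) e1.symm).congr_deriv ?_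
  rw [show t + 2 + i = t + 1 + (i + 1) by omega, Real.div_rpow hci.le hc2.le]
  have e2 : X.Cbar (t + 1 + (i + 1)) ω
      / (X.Cbar t ω * (X.Cbar (t + 1 + (i + 1)) ω / X.Cbar (t + 1) ω))
      = X.growth (t + 1) ω := by
    rw [Market.growth, Nat.add_sub_cancel]
    field_simp
  have e3 : X.Cbar (t + 1 + (i + 1)) ω ^ (1 - a.θ)
      = X.Cbar (t + 1 + (i + 1)) ω ^ (-a.θ) * X.Cbar (t + 1 + (i + 1)) ω := by
    rw [sub_eq_neg_add, Real.rpow_add hci, Real.rpow_one]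
  rw [e2, e3, Φ, F]
  have := (Real.rpow_pos_of_pos hc2 (1 - a.θ)).ne'
  field_simp

end Derivatives

end ModelI

namespace ModelI

variable {Ω : Type*} [MeasurableSpace Ω] [StandardBorelSpace Ω] {P : Measure Ω}

theorem growthGap_pos {Ω : Type*} [MeasurableSpace Ω] {P : Measure Ω} {X : Market Ω} {a : Params}
    (hgrowth : a.β * ∫ ω, X.growth 1 ω ^ (1 - a.θ) ∂P < 1) : 0 < growthGap a P X :=
  sub_pos.2 hgrowth

/-! ### The stochastic discount factor in terms of consumption and wealth -/

section StochasticDiscountFactor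

variable [IsProbabilityMeasure P] {X : Market Ω} {a : Params} {p : Plan Ω}

omit [StandardBorelSpace Ω] [IsProbabilityMeasure P] in
-- A geometric series with ratio `β 𝔼[ε^(1-θ)]`, which lies in `[0, 1)` by the growth condition.
theorem hasSum_discounted (hX : X.Standing P)
    (hgrowth : a.β * ∫ ω, X.growth 1 ω ^ (1 - a.θ) ∂P < 1) (A : ℝ) :
    HasSum (fun i : ℕ => a.β ^ (i + 1) * (A * (∫ ω, X.growth 1 ω ^ (1 - a.θ) ∂P) ^ i))
      (a.β * A / growthGap a P X) := by
  have h0 := mul_nonneg a.β_pos.le (hX.integral_growth_rpow_nonneg a)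
  have h := (hasSum_geometric_of_lt_one h0 hgrowth).mul_left (a.β * A)
  rw [growthGap, div_eq_mul_inv]
  refine h.congr_fun fun i => ?_
  rw [mul_pow]
  ring

/-- Marginal prospective utility at `t + 1` of wealth at `t + 2`, for consumption at `t + 2`. -/
noncomputable def marginalProsp (a : Params) (P : Measure Ω) (X : Market Ω) (p : Plan Ω) (t : ℕ) (ω : Ω) : ℝ :=
  Φ a P X (X.growth (t + 1) ω) * X.Cbar (t + 2) ω ^ (1 - a.θ) / p.W (t + 2) ω

theorem marginalProsp_nonneg (heq : IsEquilibrium a P X p) (hX : X.Standing P) (t : ℕ) (ω : Ω) :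
    0 ≤ marginalProsp a P X p t ω :=
  div_nonneg (mul_nonneg (Φ_nonneg _) (Real.rpow_nonneg (hX.Cbar_pos _ _).le _))
    (heq.wealth_pos hX _ _).le

theorem measurable_marginalProsp (heq : IsEquilibrium a P X p) (hX : X.Standing P) (t : ℕ) :
    Measurable[X.info (t + 2)] (marginalProsp a P X p t) :=
  ((measurable_Φ.comp (Market.measurable_info_growth (Nat.le_succ _))).mul
    ((Market.measurable_info_Cbar le_rfl).pow_const _)).div (heq.measurable_W hX _)

/-- Closed form of the stochastic discount factor in terms of consumption and wealth. -/
theorem sdf_eq (heq : IsEquilibrium a P X p) (hX : X.Standing P)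
    (hatom : ∀ x : ℝ, P.map (X.growth 1) {x} = 0)
    (hm : Integrable (fun ω => a.m (X.growth 1 ω)) P)
    (hgrowth : a.β * ∫ ω, X.growth 1 ω ^ (1 - a.θ) ∂P < 1) (t : ℕ) :
    ∀ᵐ ω ∂P, sdf a P X p (t + 1) ω =
      (a.β * (X.Cbar (t + 2) ω ^ (-a.θ) * G a P X (X.growth (t + 2) ω))
        + a.γ * (a.β * marginalProsp a P X p t ω / growthGap a P X))
      / (X.Cbar (t + 1) ω ^ (-a.θ) * G a P X (X.growth (t + 1) ω)) := by
  have hint := fun j => hX.integral_mul_growth hm (le_refl (t + 2))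
    (measurable_marginalProsp heq hX t) (marginalProsp_nonneg heq hX t) j
  filter_upwards [hasDerivAt_U heq hX hatom hm t, hasDerivAt_U heq hX hatom hm (t + 1),
    hX.ae_ae (t + 2) (hasDerivAt_prosp heq hX hatom hm t), ae_all_iff.2 hint,
    hX.ae_ae_eq_self (t + 2) (measurable_marginalProsp heq hX t)] with ω h1 h2 h3 h4 h5
  have h6 : ∀ i : ℕ, condE P X (t + 1 + 1)
      (fun ω₁ => deriv (fun w => prosp a P X p (t + 1) (i + 1) w ω₁) (p.W (t + 1 + 1) ω₁)) ω
      = marginalProsp a P X p t ω * (∫ ω, X.growth 1 ω ^ (1 - a.θ) ∂P) ^ i := by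
    intro i
    -- The marginal utility `marginalProsp` is known at `t + 2`, hence equals its conditional
    -- expectation; only growth after `t + 2` is averaged.
    rw [condE, ← (show ∫ ω', marginalProsp a P X p t ω' ∂(condExpKernel P (X.info (t + 2)) ω)
      = marginalProsp a P X p t ω by rw [integral_congr_ae h5]; simp), ← h4 i]
    refine integral_congr_ae ?_
    filter_upwards [h3] with ω' h7
    exact (h7 i).deriv
  rw [sdf, heq.clearing_endowment, heq.clearing_endowment, h1.deriv, h2.deriv]
  simp only [h6]
  rw [(hasSum_discounted hX hgrowth _).tsum_eq]

end StochasticDiscountFactor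

/-! ### Measurability and absolute bounds for utility -/

section Regularity

variable [IsFiniteMeasure P] {X : Market Ω} {a : Params} {p q : Plan Ω}

omit [StandardBorelSpace Ω] in
theorem measurable_prospAt {t s : ℕ} {w : Ω → ℝ} (hC : ∀ t, Measurable (p.C t))
    (hW : ∀ t, Measurable (p.W t)) (hw : Measurable w) :
    Measurable (Function.uncurry fun ω ω' => prospAt a p t s (w ω) ω ω') := by
  unfold Function.uncurry prospAt Chat CrefHat
  refine a.measurable_mu.comp ((a.measurable_m.comp ?_).sub (a.measurable_m.comp ?_))
  · fun_prop
  · fun_prop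

theorem measurable_prosp (hX : X.Standing P) {t s : ℕ} {w : Ω → ℝ}
    (hC : ∀ t, Measurable (p.C t)) (hW : ∀ t, Measurable (p.W t)) (hw : Measurable w) :
    Measurable fun ω => prosp a P X p t s (w ω) ω :=
  measurable_integral_condExpKernel_prod (hX.info_le _) (measurable_prospAt hC hW hw)

theorem measurable_condE {t : ℕ} {f : Ω → ℝ} (hf : Measurable f) :
    Measurable[X.info t] (condE P X t f) :=
  hf.stronglyMeasurable.integral_condExpKernel.measurable

theorem measurable_U (hX : X.Standing P) {t : ℕ} {c : Ω → ℝ}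
    (hC : ∀ t, Measurable (p.C t)) (hc : Measurable c) :
    Measurable fun ω => U a P X p t (c ω) ω := by
  unfold U
  refine (a.measurable_m.comp hc).add (Measurable.const_mul
    (measurable_integral_condExpKernel_prod (hX.info_le _) ?_) _)
  unfold Function.uncurry
  refine a.measurable_mu.comp ((a.measurable_m.comp ?_).sub (a.measurable_m.comp ?_))
  · fun_prop
  · fun_prop

theorem measurable_Utilde (hX : X.Standing P) {t : ℕ} (hC : ∀ t, Measurable (p.C t))
    (hW : ∀ t, Measurable (p.W t)) (hqC : Measurable (q.C t)) (hqW : Measurable (q.W (t + 1))) :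
    Measurable (Utilde a P X p q t) := by
  refine (measurable_U hX hC hqC).add (Measurable.const_mul (Measurable.tsum fun i =>
    Measurable.const_mul ?_ _) _)
  exact (measurable_condE (measurable_prosp hX hC hW hqW)).mono (hX.info_le t) le_rfl

theorem measurable_condLE (hX : X.Standing P) {t : ℕ} {f : Ω → ℝ≥0∞} (hf : Measurable f) :
    Measurable (condLE P X t f) :=
  (measurable_lintegral_condExpKernel hf).mono (hX.info_le t) le_rfl

theorem measurable_condLE_prospAt (hX : X.Standing P) {t s u : ℕ} {w : Ω → ℝ}
    (hC : ∀ t, Measurable (p.C t)) (hW : ∀ t, Measurable (p.W t)) (hw : Measurable w) :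
    Measurable fun ω => condLE P X u (fun ω' => ‖prospAt a p t s (w ω) ω ω'‖ₑ) ω :=
  measurable_lintegral_condExpKernel_prod (hX.info_le _) (measurable_prospAt hC hW hw).enorm

theorem measurable_absUtilde (hX : X.Standing P) {t : ℕ} (hC : ∀ t, Measurable (p.C t))
    (hW : ∀ t, Measurable (p.W t)) (hqC : Measurable (q.C t)) (hqW : Measurable (q.W (t + 1))) :
    Measurable (absUtilde a P X p q t) := by
  unfold absUtilde
  refine ((a.measurable_m.comp hqC).enorm.add (Measurable.const_mul
    (measurable_lintegral_condExpKernel_prod (hX.info_le _) ?_) _)).add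
    (Measurable.const_mul (Measurable.tsum fun i => Measurable.const_mul
      (measurable_condLE hX (measurable_condLE_prospAt hX hC hW hqW)) _) _)
  unfold Function.uncurry
  refine (a.measurable_mu.comp ((a.measurable_m.comp ?_).sub (a.measurable_m.comp ?_))).enorm
  · fun_prop
  · fun_prop

theorem enorm_condE_le (t : ℕ) (f : Ω → ℝ) (ω : Ω) :
    ‖condE P X t f ω‖ₑ ≤ condLE P X t (fun ω' => ‖f ω'‖ₑ) ω :=
  enorm_integral_le_lintegral_enorm _

theorem condLE_mono {t : ℕ} {f g : Ω → ℝ≥0∞} (h : ∀ ω, f ω ≤ g ω) (ω : Ω) :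
    condLE P X t f ω ≤ condLE P X t g ω :=
  lintegral_mono h

theorem enorm_Utilde_le (t : ℕ) (ω : Ω) :
    ‖Utilde a P X p q t ω‖ₑ ≤ absUtilde a P X p q t ω := by
  unfold Utilde absUtilde U
  refine (enorm_add_le _ _).trans (add_le_add ((enorm_add_le _ _).trans
    (add_le_add le_rfl ?_)) ?_)
  · rw [enorm_mul, Real.enorm_of_nonneg a.b_nonneg]
    gcongr
    exact enorm_condE_le _ _ _
  · rw [enorm_mul, Real.enorm_of_nonneg a.γ_nonneg]
    gcongr
    refine enorm_tsum_le_tsum_enorm.trans (ENNReal.tsum_le_tsum fun i => ?_)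
    rw [enorm_mul, Real.enorm_of_nonneg (pow_nonneg a.β_pos.le _)]
    gcongr
    exact (enorm_condE_le _ _ _).trans (condLE_mono (fun ω₁ => enorm_condE_le _ _ _) _)

end Regularity

namespace Params

variable (a : Params)

theorem enorm_mu_sub_le (x y r : ℝ) :
    ‖a.mu (x - r)‖ₑ ≤ ‖a.mu (y - r)‖ₑ + ENNReal.ofReal (a.lam * |x - y|) := by
  have h := a.abs_mu_sub_mu_le (x - r) (y - r)
  rw [sub_sub_sub_cancel_right] at h
  have h1 : |a.mu (x - r)| ≤ |a.mu (y - r)| + a.lam * |x - y| := by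
    linarith [abs_sub_abs_le_abs_sub (a.mu (x - r)) (a.mu (y - r))]
  rw [Real.enorm_eq_ofReal_abs, Real.enorm_eq_ofReal_abs,
    ← ENNReal.ofReal_add (abs_nonneg _) (mul_nonneg a.lam_pos.le (abs_nonneg _))]
  exact ENNReal.ofReal_le_ofReal h1

theorem enorm_m_le (x y : ℝ) : ‖a.m x‖ₑ ≤ ‖a.m y‖ₑ + ENNReal.ofReal |a.m x - a.m y| := by
  rw [Real.enorm_eq_ofReal_abs, Real.enorm_eq_ofReal_abs,
    ← ENNReal.ofReal_add (abs_nonneg _) (abs_nonneg _)]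
  exact ENNReal.ofReal_le_ofReal (by linarith [abs_sub_abs_le_abs_sub (a.m x) (a.m y)])

/-- The basic Lipschitz estimate for trades. A displacement proportional to at most `c` raises the
power of `c` from `-θ` to `1 - θ`, the power whose conditional expectations the growth condition
controls. -/
theorem abs_m_add_mul_sub_le {c d x y : ℝ} (hc : 0 < c) (hd : |d| ≤ c / 2)
    (hx : |x| ≤ 1) (hy : |y| ≤ 1) :
    |a.m (c + x * d) - a.m (c + y * d)| ≤ 2 ^ a.θ * c ^ (1 - a.θ) * |x - y| := by
  have key : ∀ z : ℝ, |z| ≤ 1 → c / 2 ≤ c + z * d := by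
    intro z hz
    have : |z * d| ≤ 1 * (c / 2) := by
      rw [abs_mul]
      exact mul_le_mul hz hd (abs_nonneg _) zero_le_one
    linarith [neg_abs_le (z * d)]
  refine (a.abs_m_sub_m_le hc (key x hx) (key y hy)).trans ?_
  rw [show c + x * d - (c + y * d) = (x - y) * d by ring, abs_mul,
    show (1 : ℝ) - a.θ = -a.θ + 1 by ring, Real.rpow_add hc, Real.rpow_one]
  have h1 : 0 ≤ (2 : ℝ) ^ a.θ * c ^ (-a.θ) * |x - y| := by positivity
  calc 2 ^ a.θ * c ^ (-a.θ) * (|x - y| * |d|)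
      = 2 ^ a.θ * c ^ (-a.θ) * |x - y| * |d| := by ring
    _ ≤ 2 ^ a.θ * c ^ (-a.θ) * |x - y| * c := mul_le_mul_of_nonneg_left (by linarith) h1
    _ = _ := by ring

end Params

end ModelI

namespace ModelI

variable {Ω : Type*} [MeasurableSpace Ω] [StandardBorelSpace Ω] {P : Measure Ω}
  [IsProbabilityMeasure P] {X : Market Ω} {a : Params} {p q : Plan Ω}

/-- Absolute utility changes by at most a multiple of the changes in consumption utility. -/
theorem absUtilde_le (hX : X.Standing P) (t : ℕ) (hC : ∀ t, Measurable (p.C t))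
    (hW : ∀ t, Measurable (p.W t)) (ω : Ω) :
    absUtilde a P X p q t ω ≤ absUtilde a P X p p t ω
      + ENNReal.ofReal ((1 + a.b * a.lam) * |a.m (q.C t ω) - a.m (p.C t ω)|)
      + ENNReal.ofReal a.γ * ∑' i : ℕ, ENNReal.ofReal (a.β ^ (i + 1))
        * condLE P X t (fun ω₁ => ENNReal.ofReal (a.lam *
            |a.m (Chat p t (i + 1) (q.W (t + 1) ω₁) ω₁)
              - a.m (Chat p t (i + 1) (p.W (t + 1) ω₁) ω₁)|)) ω := by
  have hb := mul_nonneg a.b_nonneg a.lam_pos.le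
  have h1 : condLE P X (t - 1) (fun ω' => ‖a.mu (a.m (q.C t ω) - a.m (p.C t ω'))‖ₑ) ω
      ≤ condLE P X (t - 1) (fun ω' => ‖a.mu (a.m (p.C t ω) - a.m (p.C t ω'))‖ₑ) ω
        + ENNReal.ofReal (a.lam * |a.m (q.C t ω) - a.m (p.C t ω)|) := by
    refine (condLE_mono (fun ω' => a.enorm_mu_sub_le _ (a.m (p.C t ω)) _) ω).trans (le_of_eq ?_)
    rw [condLE, lintegral_add_right _ measurable_const]
    simp [condLE]
  have h2 : ∀ i : ℕ, condLE P X t (fun ω₁ => condLE P X (t - 1)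
      (fun ω' => ‖prospAt a p t (i + 1) (q.W (t + 1) ω₁) ω₁ ω'‖ₑ) ω₁) ω
      ≤ condLE P X t (fun ω₁ => condLE P X (t - 1)
        (fun ω' => ‖prospAt a p t (i + 1) (p.W (t + 1) ω₁) ω₁ ω'‖ₑ) ω₁) ω
        + condLE P X t (fun ω₁ => ENNReal.ofReal (a.lam *
            |a.m (Chat p t (i + 1) (q.W (t + 1) ω₁) ω₁)
              - a.m (Chat p t (i + 1) (p.W (t + 1) ω₁) ω₁)|)) ω := by
    intro i
    have hpm := measurable_condLE_prospAt (P := P) (a := a) hX (t := t) (s := i + 1) (u := t - 1)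
      hC hW (hW (t + 1))
    rw [condLE, condLE, condLE, ← lintegral_add_left hpm]
    refine lintegral_mono fun ω₁ => (condLE_mono (fun ω' => a.enorm_mu_sub_le _
      (a.m (Chat p t (i + 1) (p.W (t + 1) ω₁) ω₁)) _) ω₁).trans (le_of_eq ?_)
    rw [condLE, lintegral_add_right _ measurable_const]
    simp [condLE, prospAt]
  have h3 := ENNReal.tsum_le_tsum fun i => mul_le_mul_right (h2 i) (ENNReal.ofReal (a.β ^ (i + 1)))
  simp only [mul_add] at h3
  rw [ENNReal.tsum_add] at h3
  have h4 := mul_le_mul_right h3 (ENNReal.ofReal a.γ)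
  have h5 := mul_le_mul_right h1 (ENNReal.ofReal a.b)
  rw [mul_add] at h4 h5
  rw [← ENNReal.ofReal_mul a.b_nonneg] at h5
  have h6 := a.enorm_m_le (q.C t ω) (p.C t ω)
  have h7 : ENNReal.ofReal ((1 + a.b * a.lam) * |a.m (q.C t ω) - a.m (p.C t ω)|)
      = ENNReal.ofReal |a.m (q.C t ω) - a.m (p.C t ω)|
        + ENNReal.ofReal (a.b * (a.lam * |a.m (q.C t ω) - a.m (p.C t ω)|)) := by
    rw [← ENNReal.ofReal_add (abs_nonneg _) (mul_nonneg a.b_nonneg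
      (mul_nonneg a.lam_pos.le (abs_nonneg _)))]
    congr 1
    ring
  refine (add_le_add (add_le_add h6 h5) h4).trans (le_of_eq ?_)
  rw [h7, absUtilde]
  ring

/-- Realized cumulative utility from `t` on. -/
noncomputable def realizedUtility (a : Params) (P : Measure Ω) [IsFiniteMeasure P] (X : Market Ω)
    (p q : Plan Ω) (t : ℕ) (ω : Ω) : ℝ :=
  ∑' k : ℕ, a.β ^ k * Utilde a P X p q (t + k) ω

theorem HasFiniteUtility.integrable {t : ℕ} (h : HasFiniteUtility a P X p q t)
    (hX : X.Standing P) (hC : ∀ t, Measurable (p.C t))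
    (hW : ∀ t, Measurable (p.W t)) (hqC : ∀ t, Measurable (q.C t))
    (hqW : ∀ t, Measurable (q.W t)) :
    ∀ᵐ ω ∂P, Integrable (realizedUtility a P X p q t) (condExpKernel P (X.info t) ω) ∧
      ∀ᵐ ω₁ ∂(condExpKernel P (X.info t) ω),
        Summable (fun k : ℕ => a.β ^ k * Utilde a P X p q (t + k) ω₁) ∧
        absUtilde a P X p q t ω₁ < ∞ := by
  have hle : ∀ ω₁, ∑' k : ℕ, ‖a.β ^ k * Utilde a P X p q (t + k) ω₁‖ₑ
      ≤ ∑' k : ℕ, ENNReal.ofReal (a.β ^ k) * absUtilde a P X p q (t + k) ω₁ := by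
    refine fun ω₁ => ENNReal.tsum_le_tsum fun k => ?_
    rw [enorm_mul, Real.enorm_of_nonneg (pow_nonneg a.β_pos.le _)]
    gcongr
    exact enorm_Utilde_le _ _
  have hmeas : Measurable fun ω₁ =>
      ∑' k : ℕ, ENNReal.ofReal (a.β ^ k) * absUtilde a P X p q (t + k) ω₁ :=
    Measurable.tsum fun k => (measurable_absUtilde hX hC hW (hqC _) (hqW _)).const_mul _
  filter_upwards [h] with ω hω
  refine ⟨⟨Measurable.aestronglyMeasurable (Measurable.tsum fun k =>
    (measurable_Utilde hX hC hW (hqC _) (hqW _)).const_mul _), ?_⟩, ?_⟩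
  · exact (lintegral_mono fun ω₁ => enorm_tsum_le_tsum_enorm.trans (hle ω₁)).trans_lt hω
  · filter_upwards [ae_lt_top hmeas hω.ne] with ω₁ h1
    refine ⟨Summable.of_enorm ((hle ω₁).trans_lt h1).ne, ?_⟩
    -- The term `k = 0` of the finite series is the absolute period utility at `t` itself.
    have := (ENNReal.le_tsum 0).trans_lt h1
    simpa using this

/-- If two plans differ in only two periods, so do their utilities. -/
theorem V_sub_V {t : ℕ} (hX : X.Standing P) (hC : ∀ t, Measurable (p.C t))
    (hW : ∀ t, Measurable (p.W t)) (hqC : ∀ t, Measurable (q.C t))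
    (hqW : ∀ t, Measurable (q.W t)) (hp : HasFiniteUtility a P X p p t)
    (hq : HasFiniteUtility a P X p q t) (hqp : ∀ s, t + 2 ≤ s → q.C s = p.C s)
    (hqpW : ∀ s, t + 2 ≤ s → q.W s = p.W s) :
    ∀ᵐ ω ∂P, V a P X p q t ω - V a P X p p t ω
      = condE P X t (fun ω₁ => (Utilde a P X p q t ω₁ - Utilde a P X p p t ω₁)
        + a.β * (Utilde a P X p q (t + 1) ω₁ - Utilde a P X p p (t + 1) ω₁)) ω := by
  filter_upwards [hp.integrable hX hC hW hC hW, hq.integrable hX hC hW hqC hqW] with ω h1 h2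
  refine (integral_sub h2.1 h1.1).symm.trans (integral_congr_ae ?_)
  filter_upwards [h1.2, h2.2] with ω₁ h3 h4
  rw [realizedUtility, realizedUtility, ← h4.1.tsum_sub h3.1, tsum_eq_sum (s := Finset.range 2)]
  · simp [Finset.sum_range_succ]
    ring
  · intro k hk
    have hk' : 1 < k := by simpa using hk
    -- Period utility at `t + k` involves consumption at `t + k` and wealth at `t + k + 1`, so
    -- nothing differs once `k ≥ 2`.
    have : Utilde a P X p q (t + k) = Utilde a P X p p (t + k) := by
      funext ω
      rw [Utilde, Utilde, hqp _ (by omega), hqpW _ (by omega)]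
    rw [this, sub_self]

theorem prosp_integrable_of_absUtilde_lt_top {t : ℕ} (hX : X.Standing P)
    (hC : ∀ t, Measurable (p.C t)) (hW : ∀ t, Measurable (p.W t)) (hqW : Measurable (q.W (t + 1)))
    (hγ : a.γ ≠ 0) {ω : Ω} (h : absUtilde a P X p q t ω < ∞) :
    (∀ i : ℕ, Integrable (fun ω₁ => prosp a P X p t (i + 1) (q.W (t + 1) ω₁) ω₁)
      (condExpKernel P (X.info t) ω)) ∧
    Summable fun i : ℕ => a.β ^ (i + 1)
        * condE P X t (fun ω₁ => prosp a P X p t (i + 1) (q.W (t + 1) ω₁) ω₁) ω := by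
  have h1 : ENNReal.ofReal a.γ * ∑' i : ℕ, ENNReal.ofReal (a.β ^ (i + 1))
        * condLE P X t (fun ω₁ => condLE P X (t - 1)
            (fun ω' => ‖prospAt a p t (i + 1) (q.W (t + 1) ω₁) ω₁ ω'‖ₑ) ω₁) ω < ∞ :=
    lt_of_le_of_lt le_add_self h
  have hγ' : ENNReal.ofReal a.γ ≠ 0 := by
    simpa using lt_of_le_of_ne a.γ_nonneg (Ne.symm hγ)
  have h2 := ENNReal.lt_top_of_mul_ne_top_right h1.ne hγ'
  constructor
  · intro i
    refine ⟨(measurable_prosp hX hC hW hqW).aestronglyMeasurable, ?_⟩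
    have h3 := (ENNReal.le_tsum i).trans_lt h2
    have h4 := ENNReal.lt_top_of_mul_ne_top_right h3.ne (by
      simpa using pow_pos a.β_pos (i + 1))
    exact lt_of_le_of_lt (condLE_mono (fun ω₁ => enorm_condE_le _ _ _) ω) h4
  · refine Summable.of_enorm (lt_of_le_of_lt (ENNReal.tsum_le_tsum fun i => ?_) h2).ne
    rw [enorm_mul, Real.enorm_of_nonneg (pow_nonneg a.β_pos.le _)]
    gcongr
    exact (enorm_condE_le _ _ _).trans (condLE_mono (fun ω₁ => enorm_condE_le _ _ _) _)

theorem Utilde_sub_Utilde {t : ℕ} (hX : X.Standing P)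
    (hC : ∀ t, Measurable (p.C t)) (hW : ∀ t, Measurable (p.W t)) (hqW : Measurable (q.W (t + 1)))
    {ω : Ω} (hp : absUtilde a P X p p t ω < ∞) (hq : absUtilde a P X p q t ω < ∞) :
    Utilde a P X p q t ω - Utilde a P X p p t ω
      = U a P X p t (q.C t ω) ω - U a P X p t (p.C t ω) ω
        + a.γ * ∑' i : ℕ, a.β ^ (i + 1)
          * condE P X t (fun ω₁ => prosp a P X p t (i + 1) (q.W (t + 1) ω₁) ω₁
              - prosp a P X p t (i + 1) (p.W (t + 1) ω₁) ω₁) ω := by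
  -- With `γ = 0` finite absolute utility does not control the prospective series, since `0 * ∞ = 0`
  -- in `ℝ≥0∞`; the term then drops out on both sides.
  by_cases hγ : a.γ = 0
  · simp [Utilde, hγ]
  obtain ⟨h1, h2⟩ := prosp_integrable_of_absUtilde_lt_top hX hC hW (hW _) hγ hp
  obtain ⟨h3, h4⟩ := prosp_integrable_of_absUtilde_lt_top hX hC hW hqW hγ hq
  have h5 : ∀ i, condE P X t (fun ω₁ => prosp a P X p t (i + 1) (q.W (t + 1) ω₁) ω₁
              - prosp a P X p t (i + 1) (p.W (t + 1) ω₁) ω₁) ω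
      = condE P X t (fun ω₁ => prosp a P X p t (i + 1) (q.W (t + 1) ω₁) ω₁) ω
        - condE P X t (fun ω₁ => prosp a P X p t (i + 1) (p.W (t + 1) ω₁) ω₁) ω :=
    fun i => integral_sub (h3 i) (h1 i)
  simp only [h5, mul_sub]
  rw [h4.tsum_sub h2, Utilde, Utilde]
  ring

end ModelI

/-! ### Small trades: feasibility and finite utility -/

namespace ModelI

variable {Ω : Type*} [MeasurableSpace Ω]

/-- A trade of `δ` units of consumption at `t + 1` in an asset with return `R` that can be
unwound out of consumption at `t + 2`, in either direction. -/
structure SmallTrade (P : Measure Ω) (X : Market Ω) (R : ℕ → Ω → ℝ) (t : ℕ) (δ : Ω → ℝ) :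
    Prop where
  measurable_δ : Measurable[X.info (t + 1)] δ
  pos : ∀ ω, 0 < δ ω
  le_Cbar : ∀ ω, δ ω ≤ X.Cbar (t + 1) ω / 2
  measurable_R : Measurable[X.info (t + 2)] (R (t + 2))
  R_pos : ∀ ω, 0 < R (t + 2) ω
  covered : ∀ᵐ ω ∂P, δ ω * R (t + 2) ω ≤ X.Cbar (t + 2) ω / 2
  funded : ∀ x : ℝ, |x| ≤ 1 → ∃ α : Ω → ℝ, Measurable[X.info (t + 1)] α ∧
    ∀ ω, (X.S (t + 1) ω + x * δ ω)
        * (α ω * X.RS (t + 2) ω + (1 - α ω) * X.Rf (t + 2) ω)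
      = X.S (t + 1) ω * X.RS (t + 2) ω + x * (δ ω * R (t + 2) ω)

/-- The plan `p`, modified by investing `x * δ` at `t + 1` and consuming the payoff at `t + 2`. -/
noncomputable def Plan.trade (p : Plan Ω) (R : ℕ → Ω → ℝ) (t : ℕ) (δ α : Ω → ℝ) (x : ℝ) :
    Plan Ω where
  C := Function.update (Function.update p.C (t + 1) fun ω => p.C (t + 1) ω - x * δ ω) (t + 2)
    fun ω => p.C (t + 2) ω + x * (δ ω * R (t + 2) ω)
  α := Function.update p.α (t + 1) α
  W := Function.update p.W (t + 2) fun ω => p.W (t + 2) ω + x * (δ ω * R (t + 2) ω)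

section Trade

variable {Ω : Type*} {p : Plan Ω} {R : ℕ → Ω → ℝ} {t : ℕ} {δ α : Ω → ℝ} {x : ℝ}

theorem Plan.trade_C_self : (p.trade R t δ α x).C (t + 1)
    = fun ω => p.C (t + 1) ω - x * δ ω := by
  simp [Plan.trade]

theorem Plan.trade_C_succ : (p.trade R t δ α x).C (t + 2)
    = fun ω => p.C (t + 2) ω + x * (δ ω * R (t + 2) ω) := by
  simp [Plan.trade]

theorem Plan.trade_C_of_ne {s : ℕ} (h1 : s ≠ t + 1) (h2 : s ≠ t + 2) :
    (p.trade R t δ α x).C s = p.C s := by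
  simp [Plan.trade, h1, h2]

theorem Plan.trade_α_self : (p.trade R t δ α x).α (t + 1) = α := by
  simp [Plan.trade]

theorem Plan.trade_α_of_ne {s : ℕ} (h1 : s ≠ t + 1) : (p.trade R t δ α x).α s = p.α s := by
  simp [Plan.trade, h1]

theorem Plan.trade_W_succ : (p.trade R t δ α x).W (t + 2)
    = fun ω => p.W (t + 2) ω + x * (δ ω * R (t + 2) ω) := by
  simp [Plan.trade]

theorem Plan.trade_W_of_ne {s : ℕ} (h : s ≠ t + 2) : (p.trade R t δ α x).W s = p.W s := by
  simp [Plan.trade, h]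

end Trade

variable [StandardBorelSpace Ω] {P : Measure Ω}
  [IsProbabilityMeasure P] {X : Market Ω} {a : Params} {p : Plan Ω} {R : ℕ → Ω → ℝ}
  {t : ℕ} {δ α : Ω → ℝ} {x : ℝ}

theorem IsEquilibrium.measurable_C (heq : IsEquilibrium a P X p) (t : ℕ) :
    Measurable[X.info t] (p.C t) :=
  heq.feasible.adapted_C t

omit [StandardBorelSpace Ω] [IsProbabilityMeasure P] in
theorem SmallTrade.measurable_payoff (h : SmallTrade P X R t δ) (x : ℝ) :
    Measurable[X.info (t + 2)] fun ω => x * (δ ω * R (t + 2) ω) :=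
  ((h.measurable_δ.mono (Market.info_mono (Nat.le_succ _)) le_rfl).mul
    h.measurable_R).const_mul x

omit [StandardBorelSpace Ω] [IsProbabilityMeasure P] in
theorem SmallTrade.abs_payoff_le (h : SmallTrade P X R t δ) :
    ∀ᵐ ω ∂P, |δ ω * R (t + 2) ω| ≤ X.Cbar (t + 2) ω / 2 := by
  filter_upwards [h.covered] with ω hω
  rwa [abs_of_pos (mul_pos (h.pos ω) (h.R_pos ω))]

theorem SmallTrade.measurable_trade_C (h : SmallTrade P X R t δ) (heq : IsEquilibrium a P X p)
    (s : ℕ) : Measurable[X.info s] ((p.trade R t δ α x).C s) := by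
  by_cases h1 : s = t + 1
  · subst h1
    rw [Plan.trade_C_self]
    exact (heq.measurable_C _).sub (h.measurable_δ.const_mul x)
  by_cases h2 : s = t + 2
  · subst h2
    rw [Plan.trade_C_succ]
    exact (heq.measurable_C _).add (h.measurable_payoff x)
  rw [Plan.trade_C_of_ne h1 h2]
  exact heq.measurable_C _

theorem SmallTrade.measurable_trade_W (h : SmallTrade P X R t δ) (heq : IsEquilibrium a P X p)
    (hX : X.Standing P) (s : ℕ) : Measurable[X.info s] ((p.trade R t δ α x).W s) := by
  by_cases h2 : s = t + 2
  · subst h2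
    rw [Plan.trade_W_succ]
    exact (heq.measurable_W hX _).add (h.measurable_payoff x)
  rw [Plan.trade_W_of_ne h2]
  exact heq.measurable_W hX _

theorem add_mul_pos_of_abs_le {c d x : ℝ} (hc : 0 < c) (hd : |d| ≤ c / 2) (hx : |x| ≤ 1) :
    0 < c + x * d := by
  have : |x * d| ≤ 1 * (c / 2) := by
    rw [abs_mul]
    exact mul_le_mul hx hd (abs_nonneg _) zero_le_one
  linarith [neg_abs_le (x * d)]

/-- The funding equation makes wealth at `t + 2` exceed equilibrium wealth by exactly the payoff.
The payoff is consumed at once, so later budgets are those of `p`. Consumption stays positive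
because either sign of `x` moves it by at most one half. -/
theorem SmallTrade.feasible (h : SmallTrade P X R t δ) (heq : IsEquilibrium a P X p)
    (hX : X.Standing P) (hx : |x| ≤ 1) (hα : Measurable[X.info (t + 1)] α)
    (hfund : ∀ ω, (X.S (t + 1) ω + x * δ ω)
        * (α ω * X.RS (t + 2) ω + (1 - α ω) * X.Rf (t + 2) ω)
      = X.S (t + 1) ω * X.RS (t + 2) ω + x * (δ ω * R (t + 2) ω)) :
    Feasible P X (p.trade R t δ α x) where
  adapted_C := h.measurable_trade_C heq
  adapted_α s := by
    by_cases h1 : s = t + 1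
    · subst h1
      rwa [Plan.trade_α_self]
    · rw [Plan.trade_α_of_ne h1]
      exact heq.feasible.adapted_α s
  initial ω := by
    rw [Plan.trade_W_of_ne (by omega)]
    exact heq.feasible.initial ω
  budget s ω := by
    have hp := heq.feasible.budget s ω
    by_cases h1 : s = t + 1
    · subst h1
      rw [Plan.trade_W_succ, Plan.trade_W_of_ne (by omega), Plan.trade_C_self, Plan.trade_α_self]
      simp only
      rw [hp, heq.wealth hX, heq.clearing_endowment, heq.clearing_stock]
      linear_combination -hfund ω
    by_cases h2 : s = t + 2
    · subst h2
      rw [Plan.trade_W_succ, Plan.trade_W_of_ne (by omega), Plan.trade_C_succ,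
        Plan.trade_α_of_ne h1, hp]
      ring
    rw [Plan.trade_W_of_ne (by omega), Plan.trade_W_of_ne h2, Plan.trade_C_of_ne h1 h2,
      Plan.trade_α_of_ne h1, hp]
  C_pos s := by
    by_cases h1 : s = t + 1
    · subst h1
      refine ae_of_all _ fun ω => ?_
      have := add_mul_pos_of_abs_le (x := -x) (hX.Cbar_pos (t + 1) ω)
        ((abs_of_pos (h.pos ω)).trans_le (h.le_Cbar ω)) (by rwa [abs_neg])
      rw [Plan.trade_C_self]
      beta_reduce
      rw [heq.clearing_endowment]
      linarith
    by_cases h2 : s = t + 2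
    · subst h2
      filter_upwards [h.abs_payoff_le] with ω hω
      rw [Plan.trade_C_succ]
      beta_reduce
      rw [heq.clearing_endowment]
      exact add_mul_pos_of_abs_le (hX.Cbar_pos _ _) hω hx
    rw [Plan.trade_C_of_ne h1 h2]
    exact heq.feasible.C_pos s
  W_pos s := by
    by_cases h2 : s = t + 2
    · subst h2
      filter_upwards [h.abs_payoff_le] with ω hω
      rw [Plan.trade_W_succ]
      beta_reduce
      rw [heq.wealth hX]
      have h1 := hX.S_pos (t + 2) ω
      exact add_mul_pos_of_abs_le (add_pos h1 (hX.Cbar_pos _ _)) (by linarith) hx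
    rw [Plan.trade_W_of_ne h2]
    exact heq.feasible.W_pos s

theorem Market.Standing.lintegral_Cbar_rpow (hX : X.Standing P)
    (hm : Integrable (fun ω => a.m (X.growth 1 ω)) P) (t j : ℕ) {c : ℝ} (hc : 0 ≤ c) :
    ∀ᵐ ω ∂P, condLE P X t (fun ω' => ENNReal.ofReal (c * X.Cbar (t + j) ω' ^ (1 - a.θ))) ω
      = ENNReal.ofReal (c * X.Cbar t ω ^ (1 - a.θ))
        * ENNReal.ofReal (∫ ω, X.growth 1 ω ^ (1 - a.θ) ∂P) ^ j := by
  have hf : Measurable[X.info t] fun ω => c * X.Cbar t ω ^ (1 - a.θ) :=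
    ((Market.measurable_info_Cbar le_rfl).pow_const _).const_mul c
  filter_upwards [hX.lintegral_mul_growth hm (le_refl t) hf.ennreal_ofReal j,
    hX.ae_ae_eq_self t hf] with ω h1 h2
  have h3 : ∫⁻ ω', ENNReal.ofReal (c * X.Cbar t ω' ^ (1 - a.θ))
      ∂(condExpKernel P (X.info t) ω) = ENNReal.ofReal (c * X.Cbar t ω ^ (1 - a.θ)) := by
    rw [lintegral_congr_ae (h2.mono fun ω' h => congrArg ENNReal.ofReal h)]
    simp
  rw [← h3, ← h1, condLE]
  refine lintegral_congr fun ω' => ?_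
  have p1 := hX.Cbar_pos t ω'
  have p2 := hX.Cbar_pos (t + j) ω'
  rw [← ENNReal.ofReal_mul (by positivity), Real.div_rpow p2.le p1.le]
  have := (Real.rpow_pos_of_pos p1 (1 - a.θ)).ne'
  congr 1
  field_simp

/-- Effect of a payoff on expected future consumption. -/
theorem chat_add_payoff (heq : IsEquilibrium a P X p) (hX : X.Standing P) (t i : ℕ)
    (d x : ℝ) (ω : Ω) :
    X.Cbar (t + 1 + (i + 1)) ω / p.W (t + 2) ω * (p.W (t + 2) ω + x * d)
      = X.Cbar (t + 1 + (i + 1)) ω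
        + x * (X.Cbar (t + 1 + (i + 1)) ω / p.W (t + 2) ω * d) := by
  have := (heq.wealth_pos hX (t + 2) ω).ne'
  field_simp

/-- Forecast consumption moves in proportion to wealth, and the payoff is at most `C̄ / 2 ≤ W / 2`.
-/
theorem abs_chat_payoff_le (heq : IsEquilibrium a P X p) (hX : X.Standing P) (t s : ℕ) {d : ℝ}
    {ω : Ω} (hd : |d| ≤ X.Cbar (t + 2) ω / 2) :
    |X.Cbar s ω / p.W (t + 2) ω * d| ≤ X.Cbar s ω / 2 := by
  have h1 := hX.Cbar_pos s ω
  have h2 := heq.wealth_pos hX (t + 2) ω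
  rw [abs_mul, abs_of_pos (div_pos h1 h2), div_mul_eq_mul_div, div_le_iff₀ h2]
  have h3 : |d| ≤ p.W (t + 2) ω / 2 := by
    rw [heq.wealth hX]
    linarith [hX.S_pos (t + 2) ω]
  nlinarith

/-- Compared with `p`, absolute utility can rise at two dates only. Direct consumption effects are
multiples of `C̄^(1-θ)`, and the prospective effect at `t + 1` is a series of such powers, geometric
after conditioning. All have finite conditional expectation. -/
theorem SmallTrade.hasFiniteUtility (h : SmallTrade P X R t δ) (heq : IsEquilibrium a P X p)
    (hX : X.Standing P) (hm : Integrable (fun ω => a.m (X.growth 1 ω)) P)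
    (hgrowth : a.β * ∫ ω, X.growth 1 ω ^ (1 - a.θ) ∂P < 1) (hx : |x| ≤ 1) :
    HasFiniteUtility a P X p (p.trade R t δ α x) (t + 1) := by
  set q := p.trade R t δ α x with hq
  set ρ := ∫ ω, X.growth 1 ω ^ (1 - a.θ) ∂P with hρ
  have hb : 0 ≤ 1 + a.b * a.lam := by
    have := mul_nonneg a.b_nonneg a.lam_pos.le
    linarith
  have hC : ∀ t, Measurable (p.C t) := fun s => (heq.measurable_C s).mono (hX.info_le s) le_rfl
  have hW : ∀ t, Measurable (p.W t) := fun s => (heq.measurable_W hX s).mono (hX.info_le s) le_rfl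
  set B : ℝ≥0∞ := ∑' i : ℕ, ENNReal.ofReal (a.β ^ (i + 1)) * ENNReal.ofReal ρ ^ (i + 1) with hB
  have hBfin : B < ∞ := by
    have hr : ENNReal.ofReal (a.β * ρ) < 1 := by
      rwa [ENNReal.ofReal_lt_one]
    have e : B = ENNReal.ofReal (a.β * ρ) * ∑' i : ℕ, ENNReal.ofReal (a.β * ρ) ^ i := by
      rw [hB, ← ENNReal.tsum_mul_left]
      refine tsum_congr fun i => ?_
      rw [ENNReal.ofReal_pow a.β_pos.le, ← mul_pow, ← ENNReal.ofReal_mul a.β_pos.le, pow_succ']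
    rw [e, ENNReal.tsum_geometric]
    exact ENNReal.mul_lt_top ENNReal.ofReal_lt_top
      (ENNReal.inv_lt_top.2 (tsub_pos_of_lt hr))
  set E : ℕ → Ω → ℝ≥0∞ := fun s ω =>
    ENNReal.ofReal ((1 + a.b * a.lam) * 2 ^ a.θ * X.Cbar s ω ^ (1 - a.θ)) with hE
  set E0 : Ω → ℝ≥0∞ := fun ω =>
    ENNReal.ofReal a.γ * (ENNReal.ofReal (a.lam * 2 ^ a.θ * X.Cbar (t + 1) ω ^ (1 - a.θ)) * B)
    with hE0
  have hEm : ∀ s, Measurable (E s) := fun s =>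
    (((hX.measurable_Cbar s).pow_const _).const_mul _).ennreal_ofReal
  have hE0m : Measurable E0 := (((((hX.measurable_Cbar (t + 1)).pow_const _).const_mul
    _).ennreal_ofReal).mul_const _).const_mul _
  have hbound0 : ∀ᵐ ω ∂P, absUtilde a P X p q (t + 1) ω
      ≤ absUtilde a P X p p (t + 1) ω + E (t + 1) ω + E0 ω := by
    filter_upwards [ae_all_iff.2 fun i : ℕ => hX.lintegral_Cbar_rpow hm (t + 1) (i + 1)
      (mul_nonneg a.lam_pos.le (Real.rpow_nonneg zero_le_two a.θ)),
      hX.ae_ae (t + 1) h.abs_payoff_le] with ω h1 h2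
    refine (absUtilde_le hX (t + 1) hC hW ω).trans (add_le_add (add_le_add le_rfl ?_) ?_)
    · refine ENNReal.ofReal_le_ofReal ?_
      rw [mul_assoc]
      refine mul_le_mul_of_nonneg_left ?_ hb
      have := a.abs_m_add_mul_sub_le (x := -x) (y := 0) (hX.Cbar_pos (t + 1) ω)
        ((abs_of_pos (h.pos ω)).trans_le (h.le_Cbar ω)) (by rwa [abs_neg]) (by simp)
      rw [hq, Plan.trade_C_self]
      beta_reduce
      rw [heq.clearing_endowment]
      simp only [zero_mul, add_zero, sub_zero, abs_neg, neg_mul, ← sub_eq_add_neg] at this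
      refine this.trans (mul_le_of_le_one_right ?_ hx)
      have := hX.Cbar_pos (t + 1) ω
      positivity
    · refine mul_le_mul_right ?_ _
      rw [hB, ← ENNReal.tsum_mul_left]
      refine ENNReal.tsum_le_tsum fun i => ?_
      rw [mul_left_comm, ← h1 i]
      gcongr
      refine lintegral_mono_ae ?_
      filter_upwards [h2] with ω₁ h3
      refine ENNReal.ofReal_le_ofReal ?_
      rw [mul_assoc]
      refine mul_le_mul_of_nonneg_left ?_ a.lam_pos.le
      have hc := hX.Cbar_pos (t + 1 + (i + 1)) ω₁
      have := a.abs_m_add_mul_sub_le (y := 0) hc (abs_chat_payoff_le heq hX t _ h3) hx (by simp)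
      rw [hq, Plan.trade_W_succ, chat_eq heq hX, chat_eq heq hX]
      simp only
      rw [chat_add_payoff heq hX, div_mul_cancel₀ _ (heq.wealth_pos hX (t + 2) ω₁).ne']
      simp only [zero_mul, add_zero, sub_zero] at this
      refine this.trans (mul_le_of_le_one_right ?_ hx)
      positivity
  have hsame : ∀ s, s ≠ t + 1 → ∀ ω, absUtilde a P X p q s ω ≤ absUtilde a P X p p s ω
      + ENNReal.ofReal ((1 + a.b * a.lam) * |a.m (q.C s ω) - a.m (p.C s ω)|) := by
    intro s hs ω
    refine (absUtilde_le hX s hC hW ω).trans (le_of_eq ?_)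
    rw [hq, Plan.trade_W_of_ne (by omega)]
    simp [condLE]
  have hbound1 : ∀ᵐ ω ∂P, absUtilde a P X p q (t + 2) ω
      ≤ absUtilde a P X p p (t + 2) ω + E (t + 2) ω := by
    filter_upwards [h.abs_payoff_le] with ω h1
    refine (hsame _ (by omega) ω).trans (add_le_add le_rfl (ENNReal.ofReal_le_ofReal ?_))
    rw [mul_assoc]
    refine mul_le_mul_of_nonneg_left ?_ hb
    have hc := hX.Cbar_pos (t + 2) ω
    have := a.abs_m_add_mul_sub_le (y := 0) hc h1 hx (by simp)
    rw [hq, Plan.trade_C_succ]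
    beta_reduce
    rw [heq.clearing_endowment]
    simp only [zero_mul, add_zero, sub_zero] at this
    refine this.trans (mul_le_of_le_one_right ?_ hx)
    positivity
  have hbound2 : ∀ s, t + 3 ≤ s → ∀ ω, absUtilde a P X p q s ω ≤ absUtilde a P X p p s ω := by
    intro s hs ω
    refine (hsame s (by omega) ω).trans (le_of_eq ?_)
    rw [hq, Plan.trade_C_of_ne (by omega) (by omega)]
    simp
  have hsum : ∀ᵐ ω ∂P,
      ∑' k : ℕ, ENNReal.ofReal (a.β ^ k) * absUtilde a P X p q (t + 1 + k) ω
        ≤ (∑' k : ℕ, ENNReal.ofReal (a.β ^ k) * absUtilde a P X p p (t + 1 + k) ω)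
          + ((E (t + 1) ω + E0 ω) + ENNReal.ofReal a.β * E (t + 2) ω) := by
    filter_upwards [hbound0, hbound1] with ω h0 h1
    have e : (E (t + 1) ω + E0 ω) + ENNReal.ofReal a.β * E (t + 2) ω
        = ∑' k : ℕ, if k = 0 then E (t + 1) ω + E0 ω
          else if k = 1 then ENNReal.ofReal a.β * E (t + 2) ω else 0 := by
      rw [tsum_eq_sum (s := Finset.range 2)]
      · simp [Finset.sum_range_succ]
      · intro k hk
        have hk' : 1 < k := by simpa using hk
        rw [if_neg (by omega), if_neg (by omega)]
    rw [e, ← ENNReal.tsum_add]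
    refine ENNReal.tsum_le_tsum fun k => ?_
    by_cases hk0 : k = 0
    · subst hk0
      simpa [add_assoc] using h0
    by_cases hk1 : k = 1
    · subst hk1
      simp only [hk0, if_false, if_true, pow_one]
      rw [← mul_add]
      exact mul_le_mul_right h1 _
    · simp only [hk0, hk1, if_false, add_zero]
      exact mul_le_mul_right (hbound2 _ (by omega) ω) _
  -- Horizon `0` in `lintegral_Cbar_rpow` evaluates the powers of consumption already known at `t +
  -- 1`; horizon `1` handles the effect at `t + 2`.
  filter_upwards [heq.finite (t + 1) (by omega), hX.ae_ae (t + 1) hsum,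
    hX.lintegral_Cbar_rpow hm (t + 1) 0 (mul_nonneg hb (Real.rpow_nonneg zero_le_two a.θ)),
    hX.lintegral_Cbar_rpow hm (t + 1) 0
      (mul_nonneg a.lam_pos.le (Real.rpow_nonneg zero_le_two a.θ)),
    hX.lintegral_Cbar_rpow hm (t + 1) 1 (mul_nonneg hb (Real.rpow_nonneg zero_le_two a.θ))]
    with ω h1 h2 h3 h4 h5
  refine (lintegral_mono_ae h2).trans_lt ?_
  rw [lintegral_add_right _ (((hEm _).fun_add hE0m).fun_add ((hEm _).const_mul _)),
    lintegral_add_right _ ((hEm _).const_mul _), lintegral_add_right _ hE0m,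
    lintegral_const_mul _ (hEm _), lintegral_const_mul _ ((((hX.measurable_Cbar (t + 1)).pow_const _).const_mul
      _).ennreal_ofReal.mul_const _),
    lintegral_mul_const _ (((hX.measurable_Cbar (t + 1)).pow_const _).const_mul
      _).ennreal_ofReal]
  unfold condLE at h1 h3 h4 h5
  simp only [add_zero] at h3 h4
  rw [hE]
  simp only
  rw [h3, h4, h5]
  refine ENNReal.add_lt_top.2 ⟨h1, ?_⟩
  finiteness

/-- Testing only `±1/(n+1)` suffices for the two one-sided slopes. Optimality holds for each trade
size off its own null set, so only countably many sizes can be used on one path. -/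
theorem eq_zero_of_hasDerivAt_of_nonpos {f : ℝ → ℝ} {f' : ℝ} (hf : HasDerivAt f f' 0)
    (h0 : f 0 = 0) (h1 : ∀ n : ℕ, f (1 / (n + 1)) ≤ 0) (h2 : ∀ n : ℕ, f (-(1 / (n + 1))) ≤ 0) :
    f' = 0 := by
  have hs := hasDerivAt_iff_tendsto_slope_zero.1 hf
  have ht : Filter.Tendsto (fun n : ℕ => (1 : ℝ) / (n + 1)) Filter.atTop (nhdsWithin 0 {0}ᶜ) :=
    tendsto_nhdsWithin_iff.2 ⟨tendsto_one_div_add_atTop_nhds_zero_nat,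
      Filter.Eventually.of_forall fun n => (Nat.one_div_pos_of_nat (α := ℝ)).ne'⟩
  have ht' : Filter.Tendsto (fun n : ℕ => -((1 : ℝ) / (n + 1))) Filter.atTop
      (nhdsWithin 0 {0}ᶜ) :=
    tendsto_nhdsWithin_iff.2 ⟨by
      simpa using (tendsto_one_div_add_atTop_nhds_zero_nat (𝕜 := ℝ)).neg,
      Filter.Eventually.of_forall fun n => by
        have := (Nat.one_div_pos_of_nat (α := ℝ) (n := n)).ne'
        simpa using this⟩
  refine le_antisymm (le_of_tendsto' (hs.comp ht) fun n => ?_)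
    (ge_of_tendsto' (hs.comp ht') fun n => ?_)
  · simp only [Function.comp_apply, zero_add, h0, sub_zero, smul_eq_mul]
    exact mul_nonpos_of_nonneg_of_nonpos
      (inv_nonneg.2 (Nat.one_div_pos_of_nat (α := ℝ)).le) (h1 n)
  · simp only [Function.comp_apply, zero_add, h0, sub_zero, smul_eq_mul]
    exact mul_nonneg_of_nonpos_of_nonpos
      (inv_nonpos.2 (neg_nonpos.2 (Nat.one_div_pos_of_nat (α := ℝ)).le)) (h2 n)

end ModelI

/-! ### Differentiating the expected utility changes of a trade -/

namespace ModelI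

variable {Ω : Type*} [MeasurableSpace Ω] [StandardBorelSpace Ω] {P : Measure Ω}
  [IsProbabilityMeasure P] {X : Market Ω} {a : Params} {p : Plan Ω} {R : ℕ → Ω → ℝ}
  {t : ℕ} {δ α : Ω → ℝ} {x : ℝ}

theorem abs_U_sub_U_le (heq : IsEquilibrium a P X p) (hX : X.Standing P)
    (hm : Integrable (fun ω => a.m (X.growth 1 ω)) P) (t : ℕ) :
    ∀ᵐ ω ∂P, ∀ c c' : ℝ, |U a P X p (t + 1) c ω - U a P X p (t + 1) c' ω|
      ≤ (1 + a.b * a.lam) * |a.m c - a.m c'| := by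
  have := Measure.isProbabilityMeasure_map (μ := P) (hX.measurable_growth 1).aemeasurable
  filter_upwards [U_eq_gainLoss heq hX t] with ω h c c'
  rw [h, h]
  have h1 := a.abs_gainLoss_sub_le hX.ae_pos (hX.integrable_m_map hm) c c' (hX.Cbar_pos t ω)
  rw [add_sub_add_comm, ← mul_sub]
  refine (abs_add_le _ _).trans ?_
  rw [abs_mul, abs_of_nonneg a.b_nonneg]
  have := mul_le_mul_of_nonneg_left h1 a.b_nonneg
  linarith

theorem abs_prosp_sub_prosp_le (heq : IsEquilibrium a P X p) (hX : X.Standing P)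
    (hm : Integrable (fun ω => a.m (X.growth 1 ω)) P) (t : ℕ) :
    ∀ᵐ ω ∂P, ∀ (i : ℕ) (w w' : ℝ),
      |prosp a P X p (t + 1) (i + 1) w ω - prosp a P X p (t + 1) (i + 1) w' ω|
      ≤ a.lam * |a.m (X.Cbar (t + 1 + (i + 1)) ω / p.W (t + 2) ω * w)
          - a.m (X.Cbar (t + 1 + (i + 1)) ω / p.W (t + 2) ω * w')| := by
  have := Measure.isProbabilityMeasure_map (μ := P) (hX.measurable_growth 1).aemeasurable
  filter_upwards [prosp_eq_gainLoss heq hX t] with ω h i w w'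
  rw [h, h]
  exact a.abs_gainLoss_sub_le hX.ae_pos (hX.integrable_m_map hm) _ _
    (mul_pos (hX.Cbar_pos t ω) (div_pos (hX.Cbar_pos _ ω) (hX.Cbar_pos _ ω)))

theorem Market.Standing.integrable_Cbar_rpow (hX : X.Standing P)
    (hm : Integrable (fun ω => a.m (X.growth 1 ω)) P) (t j : ℕ) :
    ∀ᵐ ω ∂P, Integrable (fun ω' => X.Cbar (t + j) ω' ^ (1 - a.θ)) (condExpKernel P (X.info t) ω) ∧
      ∫ ω', X.Cbar (t + j) ω' ^ (1 - a.θ) ∂(condExpKernel P (X.info t) ω)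
        = X.Cbar t ω ^ (1 - a.θ) * (∫ ω, X.growth 1 ω ^ (1 - a.θ) ∂P) ^ j := by
  filter_upwards [hX.lintegral_Cbar_rpow hm t j zero_le_one] with ω h
  simp only [one_mul, condLE] at h
  have hnn : ∀ s ω, 0 ≤ X.Cbar s ω ^ (1 - a.θ) := fun s ω =>
    Real.rpow_nonneg (hX.Cbar_pos s ω).le _
  have hmeas := ((hX.measurable_Cbar (t + j)).pow_const (1 - a.θ)).aestronglyMeasurable
    (μ := condExpKernel P (X.info t) ω)
  refine ⟨⟨hmeas, ?_⟩, ?_⟩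
  · rw [hasFiniteIntegral_iff_ofReal (ae_of_all _ (hnn _)), h]
    finiteness
  · rw [integral_eq_lintegral_of_nonneg_ae (ae_of_all _ (hnn _)) hmeas, h, ENNReal.toReal_mul,
      ENNReal.toReal_ofReal (hnn _ _), ENNReal.toReal_pow,
      ENNReal.toReal_ofReal (hX.integral_growth_rpow_nonneg a)]

/-- The change in prospective utility caused by a payoff `x * d` at `t + 2`. -/
noncomputable def prospChange (a : Params) (P : Measure Ω) [IsFiniteMeasure P] (X : Market Ω)
    (p : Plan Ω) (t i : ℕ) (d : Ω → ℝ) (x : ℝ) (ω : Ω) : ℝ :=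
  prosp a P X p (t + 1) (i + 1) (p.W (t + 2) ω + x * d ω) ω
    - prosp a P X p (t + 1) (i + 1) (p.W (t + 2) ω) ω

/-- The change in the utility of consumption at `t + 1` caused by a payoff `x * d`. -/
noncomputable def UChange (a : Params) (P : Measure Ω) [IsFiniteMeasure P] (X : Market Ω)
    (p : Plan Ω) (t : ℕ) (d : Ω → ℝ) (x : ℝ) (ω : Ω) : ℝ :=
  U a P X p (t + 1) (X.Cbar (t + 1) ω + x * d ω) ω - U a P X p (t + 1) (X.Cbar (t + 1) ω) ω

theorem measurable_UChange (heq : IsEquilibrium a P X p) (hX : X.Standing P) (t : ℕ) {d : Ω → ℝ}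
    (hd : Measurable d) (x : ℝ) : Measurable (UChange a P X p t d x) := by
  have hC : ∀ t, Measurable (p.C t) := fun s => (heq.measurable_C s).mono (hX.info_le s) le_rfl
  exact (measurable_U hX hC ((hX.measurable_Cbar _).add (hd.const_mul x))).sub
    (measurable_U hX hC (hX.measurable_Cbar _))

theorem measurable_prospChange (heq : IsEquilibrium a P X p) (hX : X.Standing P) (t i : ℕ)
    {d : Ω → ℝ} (hd : Measurable d) (x : ℝ) : Measurable (prospChange a P X p t i d x) := by
  have hC : ∀ t, Measurable (p.C t) := fun s => (heq.measurable_C s).mono (hX.info_le s) le_rfl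
  have hW : ∀ t, Measurable (p.W t) := fun s => (heq.measurable_W hX s).mono (hX.info_le s) le_rfl
  exact (measurable_prosp hX hC hW ((hW _).add (hd.const_mul x))).sub
    (measurable_prosp hX hC hW (hW _))

theorem abs_UChange_sub_le (heq : IsEquilibrium a P X p) (hX : X.Standing P)
    (hm : Integrable (fun ω => a.m (X.growth 1 ω)) P) (t : ℕ) {d : Ω → ℝ}
    (hd : ∀ᵐ ω ∂P, |d ω| ≤ X.Cbar (t + 1) ω / 2) :
    ∀ᵐ ω ∂P, ∀ x y : ℝ, |x| ≤ 1 → |y| ≤ 1 →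
      |UChange a P X p t d x ω - UChange a P X p t d y ω|
      ≤ (1 + a.b * a.lam) * (2 ^ a.θ * X.Cbar (t + 1) ω ^ (1 - a.θ)) * |x - y| := by
  filter_upwards [abs_U_sub_U_le heq hX hm t, hd] with ω h1 h2 x y hx hy
  rw [UChange, UChange, sub_sub_sub_cancel_right, mul_assoc]
  refine (h1 _ _).trans (mul_le_mul_of_nonneg_left
    (a.abs_m_add_mul_sub_le (hX.Cbar_pos _ _) h2 hx hy) ?_)
  have := mul_nonneg a.b_nonneg a.lam_pos.le
  linarith

theorem abs_prospChange_sub_le (heq : IsEquilibrium a P X p) (hX : X.Standing P)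
    (hm : Integrable (fun ω => a.m (X.growth 1 ω)) P) (t : ℕ) {d : Ω → ℝ}
    (hd : ∀ᵐ ω ∂P, |d ω| ≤ X.Cbar (t + 2) ω / 2) :
    ∀ᵐ ω ∂P, ∀ (i : ℕ) (x y : ℝ), |x| ≤ 1 → |y| ≤ 1 →
      |prospChange a P X p t i d x ω - prospChange a P X p t i d y ω|
      ≤ a.lam * (2 ^ a.θ * X.Cbar (t + 1 + (i + 1)) ω ^ (1 - a.θ)) * |x - y| := by
  filter_upwards [abs_prosp_sub_prosp_le heq hX hm t, hd] with ω h1 h2 i x y hx hy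
  rw [prospChange, prospChange, sub_sub_sub_cancel_right, mul_assoc]
  refine (h1 _ _ _).trans (mul_le_mul_of_nonneg_left ?_ a.lam_pos.le)
  rw [chat_add_payoff heq hX, chat_add_payoff heq hX]
  exact a.abs_m_add_mul_sub_le (hX.Cbar_pos _ _) (abs_chat_payoff_le heq hX t _ h2) hx hy

omit [StandardBorelSpace Ω] [IsProbabilityMeasure P] in
/-- Differentiation under the integral sign at `0`, for integrands that are Lipschitz on the unit
interval. -/
theorem hasDerivAt_integral_of_lipschitz {μ : Measure Ω} {F : ℝ → Ω → ℝ} {F' bound : Ω → ℝ}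
    (hF : ∀ x, Measurable (F x)) (h0 : F 0 = 0) (hF' : Measurable F')
    (hlip : ∀ᵐ ω ∂μ, ∀ x y : ℝ, |x| ≤ 1 → |y| ≤ 1 → |F x ω - F y ω| ≤ bound ω * |x - y|)
    (hbound : Integrable bound μ) (hpos : ∀ ω, 0 ≤ bound ω)
    (hderiv : ∀ᵐ ω ∂μ, HasDerivAt (fun x => F x ω) (F' ω) 0) :
    Integrable F' μ ∧ HasDerivAt (fun x => ∫ ω, F x ω ∂μ) (∫ ω, F' ω ∂μ) 0 := by
  refine hasDerivAt_integral_of_dominated_loc_of_lip (bound := bound)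
    (Metric.ball_mem_nhds (0 : ℝ) one_pos)
    (Filter.Eventually.of_forall fun x => (hF x).aestronglyMeasurable)
    (by rw [h0]; exact integrable_zero _ _ _) hF'.aestronglyMeasurable ?_ hbound hderiv
  filter_upwards [hlip] with ω h
  refine LipschitzOnWith.of_dist_le_mul fun x hx y hy => ?_
  rw [Real.dist_eq, Real.dist_eq, Real.coe_nnabs, abs_of_nonneg (hpos ω)]
  rw [mem_ball_zero_iff, Real.norm_eq_abs] at hx hy
  exact h x y hx.le hy.le

theorem hasDerivAt_condE_UChange (heq : IsEquilibrium a P X p) (hX : X.Standing P)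
    (hatom : ∀ x : ℝ, P.map (X.growth 1) {x} = 0)
    (hm : Integrable (fun ω => a.m (X.growth 1 ω)) P) (t : ℕ) {d : Ω → ℝ}
    (hd : ∀ᵐ ω ∂P, |d ω| ≤ X.Cbar (t + 2) ω / 2) (hdm : Measurable d) :
    ∀ᵐ ω ∂P,
      Integrable (fun ω₁ => X.Cbar (t + 2) ω₁ ^ (-a.θ) * G a P X (X.growth (t + 2) ω₁) * d ω₁)
        (condExpKernel P (X.info (t + 1)) ω) ∧
      HasDerivAt (fun x => condE P X (t + 1) (UChange a P X p (t + 1) d x) ω)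
        (condE P X (t + 1)
          (fun ω₁ => X.Cbar (t + 2) ω₁ ^ (-a.θ) * G a P X (X.growth (t + 2) ω₁) * d ω₁) ω) 0 := by
  have hderiv : ∀ᵐ ω ∂P, HasDerivAt (fun x => UChange a P X p (t + 1) d x ω)
      (X.Cbar (t + 2) ω ^ (-a.θ) * G a P X (X.growth (t + 2) ω) * d ω) 0 := by
    filter_upwards [hasDerivAt_U heq hX hatom hm (t + 1)] with ω h
    have h1 : HasDerivAt (fun x => X.Cbar (t + 2) ω + x * d ω) (d ω) 0 := by
      simpa using ((hasDerivAt_id (0 : ℝ)).mul_const (d ω)).const_add (X.Cbar (t + 2) ω)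
    exact (h.comp_of_eq 0 h1 (by simp)).sub_const _
  filter_upwards [hX.ae_ae (t + 1) hderiv, hX.ae_ae (t + 1)
    (abs_UChange_sub_le heq hX hm (t + 1) hd), hX.integrable_Cbar_rpow hm (t + 1) 1] with ω h1 h2 h3
  have hb : 0 ≤ 1 + a.b * a.lam := by
    have := mul_nonneg a.b_nonneg a.lam_pos.le
    linarith
  refine hasDerivAt_integral_of_lipschitz (fun x => measurable_UChange heq hX _ hdm x) ?_ ?_ h2
    ((h3.1.const_mul _).const_mul _) (fun ω => ?_) h1
  · funext ω
    simp [UChange]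
  · exact (((hX.measurable_Cbar _).pow_const _).mul
      (measurable_G.comp (hX.measurable_growth _))).mul hdm
  · have := hX.Cbar_pos (t + 2) ω
    positivity

theorem hasDerivAt_condE_prospChange (heq : IsEquilibrium a P X p) (hX : X.Standing P)
    (hatom : ∀ x : ℝ, P.map (X.growth 1) {x} = 0)
    (hm : Integrable (fun ω => a.m (X.growth 1 ω)) P) (t i : ℕ) {d : Ω → ℝ}
    (hd : ∀ᵐ ω ∂P, |d ω| ≤ X.Cbar (t + 2) ω / 2) (hdm : Measurable d) :
    ∀ᵐ ω ∂P,
      Integrable (fun ω₁ => marginalProsp a P X p t ω₁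
          * (X.Cbar (t + 2 + i) ω₁ / X.Cbar (t + 2) ω₁) ^ (1 - a.θ) * d ω₁)
        (condExpKernel P (X.info (t + 1)) ω) ∧
      HasDerivAt (fun x => condE P X (t + 1) (prospChange a P X p t i d x) ω)
        (condE P X (t + 1) (fun ω₁ => marginalProsp a P X p t ω₁
          * (X.Cbar (t + 2 + i) ω₁ / X.Cbar (t + 2) ω₁) ^ (1 - a.θ) * d ω₁) ω) 0 := by
  have hderiv : ∀ᵐ ω ∂P, HasDerivAt (fun x => prospChange a P X p t i d x ω)
      (marginalProsp a P X p t ω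
          * (X.Cbar (t + 2 + i) ω / X.Cbar (t + 2) ω) ^ (1 - a.θ) * d ω) 0 := by
    filter_upwards [hasDerivAt_prosp heq hX hatom hm t] with ω h
    have h1 : HasDerivAt (fun x => p.W (t + 2) ω + x * d ω) (d ω) 0 := by
      simpa using ((hasDerivAt_id (0 : ℝ)).mul_const (d ω)).const_add (p.W (t + 2) ω)
    exact ((h i).comp_of_eq 0 h1 (by simp)).sub_const _
  filter_upwards [hX.ae_ae (t + 1) hderiv, hX.ae_ae (t + 1)
    (abs_prospChange_sub_le heq hX hm t hd), hX.integrable_Cbar_rpow hm (t + 1) (i + 1)]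
    with ω h1 h2 h3
  refine hasDerivAt_integral_of_lipschitz (fun x => measurable_prospChange heq hX _ _ hdm x) ?_ ?_
    (h2.mono fun ω₁ h => h i) ((h3.1.const_mul _).const_mul _) (fun ω => ?_) h1
  · funext ω
    simp [prospChange]
  · exact (((measurable_marginalProsp heq hX t).mono (hX.info_le _) le_rfl).mul
      (((hX.measurable_Cbar _).div (hX.measurable_Cbar _)).pow_const _)).mul hdm
  · have := hX.Cbar_pos (t + 1 + (i + 1)) ω
    have := a.lam_pos
    positivity

theorem abs_condE_prospChange_le (heq : IsEquilibrium a P X p) (hX : X.Standing P)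
    (hm : Integrable (fun ω => a.m (X.growth 1 ω)) P) (t : ℕ) {d : Ω → ℝ}
    (hd : ∀ᵐ ω ∂P, |d ω| ≤ X.Cbar (t + 2) ω / 2) :
    ∀ᵐ ω ∂P, ∀ (i : ℕ) (x : ℝ), |x| ≤ 1 → |condE P X (t + 1) (prospChange a P X p t i d x) ω|
      ≤ a.lam * 2 ^ a.θ * |x| * X.Cbar (t + 1) ω ^ (1 - a.θ)
        * (∫ ω, X.growth 1 ω ^ (1 - a.θ) ∂P) ^ (i + 1) := by
  filter_upwards [hX.ae_ae (t + 1) (abs_prospChange_sub_le heq hX hm t hd),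
    ae_all_iff.2 fun i : ℕ => hX.integrable_Cbar_rpow hm (t + 1) (i + 1)] with ω h1 h2 i x hx
  rw [mul_assoc, ← (h2 i).2, ← integral_const_mul]
  change ‖∫ ω', prospChange a P X p t i d x ω' ∂(condExpKernel P (X.info (t + 1)) ω)‖ ≤ _
  refine norm_integral_le_of_norm_le ((h2 i).1.const_mul _) ?_
  filter_upwards [h1] with ω₁ h3
  have := h3 i x 0 hx (by simp)
  have e : prospChange a P X p t i d 0 ω₁ = 0 := by simp [prospChange]
  rw [e, sub_zero, sub_zero] at this
  rw [Real.norm_eq_abs]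
  linarith

/-- Marginal prospective utility of the payoff, summed over all horizons. -/
theorem hasDerivAt_tsum_prospChange (heq : IsEquilibrium a P X p) (hX : X.Standing P)
    (hatom : ∀ x : ℝ, P.map (X.growth 1) {x} = 0)
    (hm : Integrable (fun ω => a.m (X.growth 1 ω)) P)
    (hgrowth : a.β * ∫ ω, X.growth 1 ω ^ (1 - a.θ) ∂P < 1) (t : ℕ) {d : Ω → ℝ}
    (hd : ∀ᵐ ω ∂P, |d ω| ≤ X.Cbar (t + 2) ω / 2) (hdm : Measurable[X.info (t + 2)] d)
    (hd0 : ∀ ω, 0 ≤ d ω) :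
    ∀ᵐ ω ∂P,
      Integrable (fun ω₁ => marginalProsp a P X p t ω₁ * d ω₁)
        (condExpKernel P (X.info (t + 1)) ω) ∧
      HasDerivAt (fun x => ∑' i : ℕ, a.β ^ (i + 1)
          * condE P X (t + 1) (prospChange a P X p t i d x) ω)
        (a.β * condE P X (t + 1) (fun ω₁ => marginalProsp a P X p t ω₁ * d ω₁) ω
          / growthGap a P X) 0 := by
  have hdm' := hdm.mono (hX.info_le _) le_rfl
  filter_upwards [ae_all_iff.2 fun i => hasDerivAt_condE_prospChange heq hX hatom hm t i hd hdm',
    abs_condE_prospChange_le heq hX hm t hd,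
    ae_all_iff.2 fun i => hX.integral_mul_growth hm (Nat.le_succ (t + 1))
      ((measurable_marginalProsp heq hX t).mul hdm)
      (fun ω => mul_nonneg (marginalProsp_nonneg heq hX t ω) (hd0 ω)) i] with ω h1 h2 h3
  have h4 : ∀ i, condE P X (t + 1) (fun ω₁ => marginalProsp a P X p t ω₁
          * (X.Cbar (t + 2 + i) ω₁ / X.Cbar (t + 2) ω₁) ^ (1 - a.θ) * d ω₁) ω
      = condE P X (t + 1) (fun ω₁ => marginalProsp a P X p t ω₁ * d ω₁) ω
        * (∫ ω, X.growth 1 ω ^ (1 - a.θ) ∂P) ^ i := by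
    intro i
    rw [condE, condE]
    refine Eq.trans ?_ (h3 i)
    refine integral_congr_ae (ae_of_all _ fun ω₁ => ?_)
    simp only [Pi.mul_apply]
    ring
  simp only [h4] at h1
  constructor
  -- At horizon `i = 0` the growth factor is `1`, which leaves the required integrand.
  · refine (h1 0).1.congr (ae_of_all _ fun ω₁ => ?_)
    simp [(hX.Cbar_pos (t + 2) ω₁).ne']
  rw [← (hasSum_discounted hX hgrowth _).tsum_eq, hasDerivAt_iff_tendsto_slope_zero]
  have h0 : ∀ i, condE P X (t + 1) (prospChange a P X p t i d 0) ω = 0 := by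
    intro i
    simp [condE, prospChange]
  simp only [h0, zero_add, mul_zero, tsum_zero, sub_zero, smul_eq_mul, ← tsum_mul_left]
  -- The difference quotients converge termwise. Dividing the Lipschitz bound by `|x|` gives a
  -- majorant uniform in `x` and geometric in the horizon.
  refine tendsto_tsum_of_dominated_convergence (bound := fun i => a.β ^ (i + 1) *
    (a.lam * 2 ^ a.θ * X.Cbar (t + 1) ω ^ (1 - a.θ) * (∫ ω, X.growth 1 ω ^ (1 - a.θ) ∂P) *
      (∫ ω, X.growth 1 ω ^ (1 - a.θ) ∂P) ^ i)) (hasSum_discounted hX hgrowth _).summable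
    (fun i => ?_) ?_
  · have h5 := (hasDerivAt_iff_tendsto_slope_zero.1 (h1 i).2).const_mul (a.β ^ (i + 1))
    refine h5.congr fun x => ?_
    simp only [h0, zero_add, sub_zero, smul_eq_mul]
    ring
  · have : ∀ᶠ x : ℝ in nhdsWithin 0 {0}ᶜ, |x| ≤ 1 ∧ x ≠ 0 := by
      filter_upwards [nhdsWithin_le_nhds (Metric.ball_mem_nhds (0 : ℝ) one_pos),
        self_mem_nhdsWithin] with x hx hx0
      rw [mem_ball_zero_iff, Real.norm_eq_abs] at hx
      exact ⟨hx.le, hx0⟩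
    filter_upwards [this] with x hx i
    have hx0 := abs_pos.2 hx.2
    rw [Real.norm_eq_abs, abs_mul, abs_mul, abs_inv, abs_of_pos (pow_pos a.β_pos _),
      mul_left_comm]
    refine mul_le_mul_of_nonneg_left ?_ (pow_pos a.β_pos _).le
    rw [inv_mul_le_iff₀ hx0]
    refine (h2 i x hx.1).trans (le_of_eq ?_)
    ring

theorem measurable_tsum_nat {Ω : Type*} {m : MeasurableSpace Ω} {f : ℕ → Ω → ℝ}
    (hf : ∀ i, Measurable[m] (f i)) : Measurable[m] fun ω => ∑' i, f i ω :=
  Measurable.tsum hf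

end ModelI

/-! ### First-order condition and Euler equations -/

namespace ModelI

variable {Ω : Type*} [MeasurableSpace Ω] [StandardBorelSpace Ω] {P : Measure Ω}
  [IsProbabilityMeasure P] {X : Market Ω} {a : Params} {p : Plan Ω} {R : ℕ → Ω → ℝ}
  {t : ℕ} {δ α : Ω → ℝ} {x : ℝ}

/-- The change in cumulative utility caused by a small trade. -/
theorem SmallTrade.V_sub_V (h : SmallTrade P X R t δ) (heq : IsEquilibrium a P X p)
    (hX : X.Standing P) (hm : Integrable (fun ω => a.m (X.growth 1 ω)) P)
    (hgrowth : a.β * ∫ ω, X.growth 1 ω ^ (1 - a.θ) ∂P < 1) (hx : |x| ≤ 1) :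
    ∀ᵐ ω ∂P, V a P X p (p.trade R t δ α x) (t + 1) ω - V a P X p p (t + 1) ω
      = UChange a P X p t δ (-x) ω
        + a.γ * ∑' i : ℕ, a.β ^ (i + 1) * condE P X (t + 1)
            (prospChange a P X p t i (fun ω => δ ω * R (t + 2) ω) x) ω
        + a.β * condE P X (t + 1)
            (UChange a P X p (t + 1) (fun ω => δ ω * R (t + 2) ω) x) ω := by
  set q := p.trade R t δ α x with hq
  set d : Ω → ℝ := fun ω => δ ω * R (t + 2) ω with hd
  have hdm : Measurable d := ((h.measurable_δ.mono (hX.info_le _) le_rfl).mul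
    (h.measurable_R.mono (hX.info_le _) le_rfl))
  have hC : ∀ t, Measurable (p.C t) := fun s => (heq.measurable_C s).mono (hX.info_le s) le_rfl
  have hW : ∀ t, Measurable (p.W t) := fun s => (heq.measurable_W hX s).mono (hX.info_le s) le_rfl
  have hqC : ∀ t, Measurable (q.C t) := fun s =>
    (h.measurable_trade_C heq s).mono (hX.info_le s) le_rfl
  have hqW : ∀ t, Measurable (q.W t) := fun s =>
    (h.measurable_trade_W heq hX s).mono (hX.info_le s) le_rfl
  have hfp := heq.finite (t + 1) (by omega)
  have hfq : HasFiniteUtility a P X p q (t + 1) := h.hasFiniteUtility heq hX hm hgrowth hx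
  set H : Ω → ℝ := fun ω => UChange a P X p t δ (-x) ω
        + a.γ * ∑' i : ℕ, a.β ^ (i + 1) * condE P X (t + 1) (prospChange a P X p t i d x) ω with hH
  -- A version of `H` visibly measurable for the information at `t + 1`: the kernel average inside
  -- `U` is replaced by its closed form. Such a version is constant under the kernel, so `H` can
  -- leave the conditional expectation.
  set H' : Ω → ℝ := fun ω =>
    (a.m (X.Cbar (t + 1) ω + -x * δ ω)
        + a.b * a.gainLoss (P.map (X.growth 1)) (X.Cbar (t + 1) ω + -x * δ ω) (X.Cbar t ω)
      - (a.m (X.Cbar (t + 1) ω)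
        + a.b * a.gainLoss (P.map (X.growth 1)) (X.Cbar (t + 1) ω) (X.Cbar t ω)))
      + a.γ * ∑' i : ℕ, a.β ^ (i + 1) * condE P X (t + 1) (prospChange a P X p t i d x) ω with hH'
  have hHH' : ∀ᵐ ω ∂P, H ω = H' ω := by
    filter_upwards [U_eq_gainLoss heq hX t] with ω h1
    simp only [hH, hH', UChange, h1]
  have hH'm : Measurable[X.info (t + 1)] H' := by
    have := Measure.isProbabilityMeasure_map (μ := P) (hX.measurable_growth 1).aemeasurable
    have c0 : Measurable[X.info (t + 1)] (X.Cbar t) :=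
      Market.measurable_info_Cbar (Nat.le_succ _)
    have c1 : Measurable[X.info (t + 1)] (X.Cbar (t + 1)) := Market.measurable_info_Cbar le_rfl
    have c2 : Measurable[X.info (t + 1)] fun ω => X.Cbar (t + 1) ω + -x * δ ω :=
      c1.add (h.measurable_δ.const_mul _)
    have c3 : Measurable[X.info (t + 1)] fun ω => ∑' i : ℕ, a.β ^ (i + 1)
        * condE P X (t + 1) (prospChange a P X p t i d x) ω :=
      measurable_tsum_nat fun i =>
        (measurable_condE (measurable_prospChange heq hX t i hdm x)).const_mul _
    exact (((a.measurable_m.comp c2).add ((a.measurable_gainLoss.comp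
      (c2.prodMk c0)).const_mul _)).sub ((a.measurable_m.comp c1).add
      ((a.measurable_gainLoss.comp (c1.prodMk c0)).const_mul _))).add
      (c3.const_mul _)
  have hJ : ∀ᵐ ω ∂P, |UChange a P X p (t + 1) d x ω|
      ≤ (1 + a.b * a.lam) * (2 ^ a.θ * X.Cbar (t + 2) ω ^ (1 - a.θ)) * |x| := by
    filter_upwards [abs_UChange_sub_le heq hX hm (t + 1) h.abs_payoff_le] with ω h1
    have h2 := h1 x 0 hx (by simp)
    have e : UChange a P X p (t + 1) d 0 ω = 0 := by simp [UChange]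
    rwa [e, sub_zero, sub_zero] at h2
  filter_upwards [ModelI.V_sub_V hX hC hW hqC hqW hfp hfq
    (fun s hs => Plan.trade_C_of_ne (by omega) (by omega))
    (fun s hs => Plan.trade_W_of_ne (by omega)), hfp.integrable hX hC hW hC hW,
    hfq.integrable hX hC hW hqC hqW, hHH', hX.ae_ae (t + 1) hHH',
    hX.ae_ae_eq_self (t + 1) hH'm, hX.ae_ae (t + 1) hJ, hX.integrable_Cbar_rpow hm (t + 1) 1]
    with ω h1 h2 h3 h4 h5 h6 h7 h8
  have hint : Integrable (UChange a P X p (t + 1) d x) (condExpKernel P (X.info (t + 1)) ω) :=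
    ((((h8.1.const_mul _).const_mul _).mul_const _).mono'
      (measurable_UChange heq hX (t + 1) hdm x).aestronglyMeasurable h7)
  rw [h1, condE]
  have e : ∫ ω₁, (H ω + a.β * UChange a P X p (t + 1) d x ω₁)
        ∂(condExpKernel P (X.info (t + 1)) ω)
      = H ω + a.β * condE P X (t + 1) (UChange a P X p (t + 1) d x) ω := by
    rw [integral_add (integrable_const _) (hint.const_mul _), integral_const_mul, condE]
    simp
  refine Eq.trans ?_ e
  refine integral_congr_ae ?_
  filter_upwards [h2.2, h3.2, h5, h6] with ω₁ g2 g3 g5 g6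
  rw [Utilde_sub_Utilde hX hC hW (hqW _) g2.2 g3.2, h4, ← g6, ← g5]
  have e1 : Utilde a P X p q (t + 1 + 1) ω₁ - Utilde a P X p p (t + 1 + 1) ω₁
      = UChange a P X p (t + 1) d x ω₁ := by
    rw [Utilde, Utilde, hq, Plan.trade_W_of_ne (by omega), Plan.trade_C_succ, UChange]
    simp only [heq.clearing_endowment, hd]
    ring
  rw [e1]
  congr 1
  rw [hH, hq, Plan.trade_C_self, Plan.trade_W_succ]
  simp only [UChange, heq.clearing_endowment, hd, neg_mul, ← sub_eq_add_neg]
  rfl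

theorem SmallTrade.V_le (h : SmallTrade P X R t δ) (heq : IsEquilibrium a P X p)
    (hX : X.Standing P) (hm : Integrable (fun ω => a.m (X.growth 1 ω)) P)
    (hgrowth : a.β * ∫ ω, X.growth 1 ω ^ (1 - a.θ) ∂P < 1) (hx : |x| ≤ 1) :
    ∀ᵐ ω ∂P, UChange a P X p t δ (-x) ω
        + a.γ * ∑' i : ℕ, a.β ^ (i + 1) * condE P X (t + 1)
            (prospChange a P X p t i (fun ω => δ ω * R (t + 2) ω) x) ω
        + a.β * condE P X (t + 1)
            (UChange a P X p (t + 1) (fun ω => δ ω * R (t + 2) ω) x) ω ≤ 0 := by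
  obtain ⟨α, hα, hfund⟩ := h.funded x hx
  filter_upwards [h.V_sub_V heq hX hm hgrowth hx (α := α), heq.optimal (t + 1) (by omega)
    (p.trade R t δ α x) (h.feasible heq hX hx hα hfund)
    (fun s hs => ⟨Plan.trade_C_of_ne (by omega) (by omega), Plan.trade_α_of_ne (by omega)⟩)
    (h.hasFiniteUtility heq hX hm hgrowth hx)] with ω h1 h2
  rw [← h1]
  exact sub_nonpos.2 h2

/-- First-order condition. -/
theorem SmallTrade.first_order (h : SmallTrade P X R t δ) (heq : IsEquilibrium a P X p)
    (hX : X.Standing P) (hatom : ∀ x : ℝ, P.map (X.growth 1) {x} = 0)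
    (hm : Integrable (fun ω => a.m (X.growth 1 ω)) P)
    (hgrowth : a.β * ∫ ω, X.growth 1 ω ^ (1 - a.θ) ∂P < 1) :
    ∀ᵐ ω ∂P,
      Integrable (fun ω₁ => X.Cbar (t + 2) ω₁ ^ (-a.θ) * G a P X (X.growth (t + 2) ω₁)
        * (δ ω₁ * R (t + 2) ω₁)) (condExpKernel P (X.info (t + 1)) ω) ∧
      Integrable (fun ω₁ => marginalProsp a P X p t ω₁ * (δ ω₁ * R (t + 2) ω₁))
        (condExpKernel P (X.info (t + 1)) ω) ∧
      X.Cbar (t + 1) ω ^ (-a.θ) * G a P X (X.growth (t + 1) ω) * δ ω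
        = a.γ * (a.β * condE P X (t + 1)
            (fun ω₁ => marginalProsp a P X p t ω₁ * (δ ω₁ * R (t + 2) ω₁)) ω / growthGap a P X)
          + a.β * condE P X (t + 1) (fun ω₁ => X.Cbar (t + 2) ω₁ ^ (-a.θ)
              * G a P X (X.growth (t + 2) ω₁) * (δ ω₁ * R (t + 2) ω₁)) ω := by
  have hdm : Measurable[X.info (t + 2)] fun ω => δ ω * R (t + 2) ω :=
    (h.measurable_δ.mono (Market.info_mono (Nat.le_succ _)) le_rfl).mul h.measurable_R
  have hn : ∀ n : ℕ, |(1 : ℝ) / (n + 1)| ≤ 1 := by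
    intro n
    rw [abs_of_pos (Nat.one_div_pos_of_nat (α := ℝ)), div_le_one (by positivity)]
    linarith [Nat.cast_nonneg (α := ℝ) n]
  filter_upwards [hasDerivAt_U heq hX hatom hm t,
    hasDerivAt_tsum_prospChange heq hX hatom hm hgrowth t h.abs_payoff_le hdm
      (fun ω => (mul_pos (h.pos ω) (h.R_pos ω)).le),
    hasDerivAt_condE_UChange heq hX hatom hm t h.abs_payoff_le (hdm.mono (hX.info_le _) le_rfl),
    ae_all_iff.2 fun n : ℕ => h.V_le heq hX hm hgrowth (hn n),
    ae_all_iff.2 fun n : ℕ => h.V_le heq hX hm hgrowth (x := -(1 / (n + 1)))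
      (by rw [abs_neg]; exact hn n)] with ω h1 h2 h3 h4 h5
  refine ⟨h3.1, h2.1, ?_⟩
  have g1 : HasDerivAt (fun x => X.Cbar (t + 1) ω + -x * δ ω) (-δ ω) 0 := by
    simpa using ((hasDerivAt_id (0 : ℝ)).neg.mul_const (δ ω)).const_add (X.Cbar (t + 1) ω)
  have g2 : HasDerivAt (fun x => UChange a P X p t δ (-x) ω)
      (X.Cbar (t + 1) ω ^ (-a.θ) * G a P X (X.growth (t + 1) ω) * -δ ω) 0 :=
    (h1.comp_of_eq 0 g1 (by simp)).sub_const _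
  have g3 := (g2.add (h2.2.const_mul a.γ)).add (h3.2.const_mul a.β)
  have g4 := eq_zero_of_hasDerivAt_of_nonpos g3
    (by simp [UChange, prospChange, condE]) h4 h5
  linarith

/-- Euler equation. -/
theorem SmallTrade.condE_sdf_mul (h : SmallTrade P X R t δ) (heq : IsEquilibrium a P X p)
    (hX : X.Standing P) (hatom : ∀ x : ℝ, P.map (X.growth 1) {x} = 0)
    (hm : Integrable (fun ω => a.m (X.growth 1 ω)) P)
    (hgrowth : a.β * ∫ ω, X.growth 1 ω ^ (1 - a.θ) ∂P < 1) :
    ∀ᵐ ω ∂P, condE P X (t + 1) (fun ω' => sdf a P X p (t + 1) ω' * R (t + 2) ω') ω = 1 := by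
  have hZm : Measurable[X.info (t + 1)]
      fun ω => X.Cbar (t + 1) ω ^ (-a.θ) * G a P X (X.growth (t + 1) ω) * δ ω :=
    (((Market.measurable_info_Cbar le_rfl).pow_const _).mul
      (measurable_G.comp (Market.measurable_info_growth le_rfl))).mul h.measurable_δ
  have hZ : ∀ ω, 0 < X.Cbar (t + 1) ω ^ (-a.θ) * G a P X (X.growth (t + 1) ω) * δ ω := fun ω =>
    mul_pos (mul_pos (Real.rpow_pos_of_pos (hX.Cbar_pos _ _) _) (G_pos _)) (h.pos ω)
  filter_upwards [h.first_order heq hX hatom hm hgrowth, hX.ae_ae_eq_self (t + 1) hZm,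
    hX.ae_ae (t + 1) (sdf_eq heq hX hatom hm hgrowth t)] with ω h1 h2 h3
  obtain ⟨i1, i2, h4⟩ := h1
  have hk := growthGap_pos hgrowth
  -- Multiplying by marginal utility times `δ`, both known at `t + 1`, clears the denominator of the
  -- discount factor and leaves the first-order condition.
  refine mul_left_cancel₀ (hZ ω).ne' ?_
  rw [condE, ← integral_const_mul, mul_one]
  conv_rhs => rw [h4, condE, condE]
  have e : a.γ * (a.β * (∫ ω₁, marginalProsp a P X p t ω₁ * (δ ω₁ * R (t + 2) ω₁)
        ∂(condExpKernel P (X.info (t + 1)) ω)) / growthGap a P X)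
      = (a.γ * a.β / growthGap a P X) * ∫ ω₁, marginalProsp a P X p t ω₁ * (δ ω₁ * R (t + 2) ω₁)
        ∂(condExpKernel P (X.info (t + 1)) ω) := by ring
  rw [e, ← integral_const_mul, ← integral_const_mul, ← integral_add (i2.const_mul _)
    (i1.const_mul _)]
  refine integral_congr_ae ?_
  filter_upwards [h2, h3] with ω₁ g2 g3
  rw [← g2, g3]
  have p1 := (Real.rpow_pos_of_pos (hX.Cbar_pos (t + 1) ω₁) (-a.θ)).ne'
  have p2 := (G_pos (a := a) (P := P) (X := X) (X.growth (t + 1) ω₁)).ne'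
  field_simp
  ring

omit [StandardBorelSpace Ω] [IsProbabilityMeasure P] in
-- Half the minimum of `δ`, `S` and `C̄` works: the halving turns `δ R ≤ C̄` into the bound `C̄ /
-- 2`, and the cap by `S` keeps invested wealth positive for both signs.
theorem TwoSidedTrade.exists_smallTrade (h : TwoSidedTrade P X R (t + 1)) (hX : X.Standing P)
    (hR : Measurable[X.info (t + 2)] (R (t + 2))) (hR0 : ∀ ω, 0 < R (t + 2) ω)
    (hfund : ∀ (δ : Ω → ℝ), Measurable[X.info (t + 1)] δ → (∀ ω, |δ ω| ≤ X.S (t + 1) ω / 2) →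
      ∃ α : Ω → ℝ, Measurable[X.info (t + 1)] α ∧ ∀ ω, (X.S (t + 1) ω + δ ω)
        * (α ω * X.RS (t + 2) ω + (1 - α ω) * X.Rf (t + 2) ω)
      = X.S (t + 1) ω * X.RS (t + 2) ω + δ ω * R (t + 2) ω) :
    ∃ δ, SmallTrade P X R t δ := by
  obtain ⟨δ, hδm, hδ, hδR⟩ := h
  have hm : Measurable[X.info (t + 1)]
      fun ω => min (δ ω) (min (X.S (t + 1) ω) (X.Cbar (t + 1) ω)) / 2 :=
    (hδm.min ((hX.measurable_S _).min (Market.measurable_info_Cbar le_rfl))).div_const 2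
  have hpos : ∀ ω, 0 < min (δ ω) (min (X.S (t + 1) ω) (X.Cbar (t + 1) ω)) / 2 := fun ω =>
    half_pos (lt_min (hδ ω) (lt_min (hX.S_pos _ _) (hX.Cbar_pos _ _)))
  refine ⟨fun ω => min (δ ω) (min (X.S (t + 1) ω) (X.Cbar (t + 1) ω)) / 2,
    hm, hpos, fun ω => ?_, hR, hR0, ?_, fun x hx => ?_⟩
  · exact div_le_div_of_nonneg_right ((min_le_right _ _).trans (min_le_right _ _)) zero_le_two
  · filter_upwards [hδR] with ω hω
    have := mul_le_mul_of_nonneg_right (min_le_left (δ ω)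
      (min (X.S (t + 1) ω) (X.Cbar (t + 1) ω))) (hR0 ω).le
    have hω' : δ ω * R (t + 2) ω ≤ X.Cbar (t + 2) ω := hω
    linarith
  · obtain ⟨α, hα, hα'⟩ := hfund _ (hm.const_mul x) fun ω => by
      rw [abs_mul, abs_of_pos (hpos ω)]
      refine (mul_le_of_le_one_left (hpos ω).le hx).trans ?_
      exact div_le_div_of_nonneg_right ((min_le_right _ _).trans (min_le_left _ _)) zero_le_two
    refine ⟨α, hα, fun ω => ?_⟩
    rw [hα' ω]
    ring

theorem condE_sdf_mul_RS (heq : IsEquilibrium a P X p)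
    (hX : X.Standing P) (hatom : ∀ x : ℝ, P.map (X.growth 1) {x} = 0)
    (hm : Integrable (fun ω => a.m (X.growth 1 ω)) P)
    (hgrowth : a.β * ∫ ω, X.growth 1 ω ^ (1 - a.θ) ∂P < 1)
    (h : TwoSidedTrade P X X.RS (t + 1)) :
    ∀ᵐ ω ∂P, condE P X (t + 1) (fun ω' => sdf a P X p (t + 1) ω' * X.RS (t + 2) ω') ω = 1 := by
  have hR : Measurable[X.info (t + 2)] (X.RS (t + 2)) :=
    ((hX.measurable_S _).add (Market.measurable_info_D le_rfl)).div
      ((hX.measurable_S (t + 1)).mono (Market.info_mono (Nat.le_succ _)) le_rfl)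
  obtain ⟨δ, hδ⟩ := h.exists_smallTrade hX hR (hX.RS_pos _) fun δ _ _ =>
    ⟨fun _ => 1, measurable_const, fun ω => by ring⟩
  exact hδ.condE_sdf_mul heq hX hatom hm hgrowth

theorem condE_sdf_mul_Rf (heq : IsEquilibrium a P X p)
    (hX : X.Standing P) (hatom : ∀ x : ℝ, P.map (X.growth 1) {x} = 0)
    (hm : Integrable (fun ω => a.m (X.growth 1 ω)) P)
    (hgrowth : a.β * ∫ ω, X.growth 1 ω ^ (1 - a.θ) ∂P < 1)
    (h : TwoSidedTrade P X X.Rf (t + 1)) :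
    ∀ᵐ ω ∂P, condE P X (t + 1) (fun ω' => sdf a P X p (t + 1) ω' * X.Rf (t + 2) ω') ω = 1 := by
  obtain ⟨δ, hδ⟩ := h.exists_smallTrade hX
    ((hX.measurable_Rf (t + 1)).mono (Market.info_mono (Nat.le_succ _)) le_rfl)
    (hX.Rf_pos (t + 1)) fun δ hδ hδS => by
      -- The stock position stays at one share, worth `S` out of savings `S + δ`; the bound `|δ| ≤ S
      -- / 2` keeps the denominator nonzero.
      refine ⟨fun ω => X.S (t + 1) ω / (X.S (t + 1) ω + δ ω),
        (hX.measurable_S _).div ((hX.measurable_S _).add hδ), fun ω => ?_⟩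
      have h1 : X.S (t + 1) ω + δ ω ≠ 0 := by
        have := hX.S_pos (t + 1) ω
        linarith [neg_abs_le (δ ω), hδS ω]
      field_simp
      ring
  exact hδ.condE_sdf_mul heq hX hatom hm hgrowth

section Weights

variable {Ω : Type*} [MeasurableSpace Ω] {P : Measure Ω} {X : Market Ω} {a : Params}

theorem Φ_le_lam (x : ℝ) : Φ a P X x ≤ a.lam := by
  have h1 := F_nonneg (P := P) (X := X) x
  have h2 := a.one_le_lam
  rw [Φ]
  nlinarith

theorem G_le (x : ℝ) : G a P X x ≤ 1 + a.b * a.lam := by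
  rw [G_eq]
  have := mul_le_mul_of_nonneg_left (Φ_le_lam (a := a) (P := P) (X := X) x) a.b_nonneg
  linarith

end Weights

end ModelI

/-! ### The price-dividend ratio and the integral equation -/

namespace ModelI

variable {Ω : Type*} [MeasurableSpace Ω] [StandardBorelSpace Ω] {P : Measure Ω}
  [IsProbabilityMeasure P] {X : Market Ω} {a : Params} {p : Plan Ω} {t : ℕ} {g : ℝ → ℝ → ℝ}

/-- The function `h` that corresponds to the price-dividend ratio `g`. -/
noncomputable def scaledPriceDividend (a : Params) (P : Measure Ω) (X : Market Ω)
    (g : ℝ → ℝ → ℝ) (x y : ℝ) : ℝ :=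
  g x y * (G a P X x * growthGap a P X)

omit [StandardBorelSpace Ω] [IsProbabilityMeasure P] in
theorem scaledPriceDividend_eq
    (hg : ∀ t, 1 ≤ t → ∀ ω, X.S t ω / X.D t ω = g (X.growth t ω) (X.ratio t ω)) (t : ℕ) (ω : Ω) :
    scaledPriceDividend a P X g (X.growth (t + 1) ω) (X.ratio (t + 1) ω)
      = X.S (t + 1) ω / X.D (t + 1) ω * (G a P X (X.growth (t + 1) ω) * growthGap a P X) := by
  rw [scaledPriceDividend, hg _ (by omega)]

omit [StandardBorelSpace Ω] [IsProbabilityMeasure P] in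
-- Since `h = (S/D) G growthGap` and `Y = C̄/D`, the factor `G growthGap / D` is common to numerator
-- and denominator and cancels.
theorem prospIntegrand_eq (hX : X.Standing P)
    (hgrowth : a.β * ∫ ω, X.growth 1 ω ^ (1 - a.θ) ∂P < 1)
    (hg : ∀ t, 1 ≤ t → ∀ ω, X.S t ω / X.D t ω = g (X.growth t ω) (X.ratio t ω)) (t : ℕ) (ω : Ω) :
    prospIntegrand a P X (scaledPriceDividend a P X g) (t + 1) ω
      = X.growth (t + 2) ω ^ (1 - a.θ) * X.ratio (t + 1) ω
        * ((X.S (t + 2) ω + X.D (t + 2) ω) / (X.S (t + 2) ω + X.Cbar (t + 2) ω)) := by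
  rw [prospIntegrand, scaledPriceDividend_eq hg]
  congr 1
  have h1 := hX.D_pos (t + 2) ω
  have h2 := hX.S_pos (t + 2) ω
  have h3 := hX.Cbar_pos (t + 2) ω
  have h4 := (G_pos (a := a) (P := P) (X := X) (X.growth (t + 2) ω))
  have h5 := growthGap_pos hgrowth
  simp only [Market.ratio, show t + 1 + 1 = t + 2 from rfl]
  rw [div_eq_div_iff (by positivity) (by positivity)]
  field_simp
  ring

omit [StandardBorelSpace Ω] [IsProbabilityMeasure P] in
theorem baseIntegrand_eq (hX : X.Standing P)
    (hg : ∀ t, 1 ≤ t → ∀ ω, X.S t ω / X.D t ω = g (X.growth t ω) (X.ratio t ω)) (t : ℕ) (ω : Ω) :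
    baseIntegrand a P X (scaledPriceDividend a P X g) (t + 1) ω
      = X.growth (t + 2) ω ^ (1 - a.θ) * X.ratio (t + 1) ω
        * ((X.S (t + 2) ω + X.D (t + 2) ω) / X.Cbar (t + 2) ω)
        * (G a P X (X.growth (t + 2) ω) * growthGap a P X) := by
  rw [baseIntegrand, scaledPriceDividend_eq hg]
  have h1 := (hX.D_pos (t + 2) ω).ne'
  have h3 := (hX.Cbar_pos (t + 2) ω).ne'
  simp only [Market.ratio, show t + 1 + 1 = t + 2 from rfl]
  field_simp

/-- Feasibility of the short position, `δ R_S ≤ C̄`, says that `(S + D) / C̄` at the later date is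
at most `S / δ` at the trading date, a known quantity. Both integrands are then bounded by a known
multiple of `C̄^(1-θ)`, as `G` is bounded. -/
theorem integrable_integrands (hX : X.Standing P)
    (hm : Integrable (fun ω => a.m (X.growth 1 ω)) P)
    (hgrowth : a.β * ∫ ω, X.growth 1 ω ^ (1 - a.θ) ∂P < 1)
    (hg : ∀ t, 1 ≤ t → ∀ ω, X.S t ω / X.D t ω = g (X.growth t ω) (X.ratio t ω))
    (h : TwoSidedTrade P X X.RS (t + 1)) :
    ∀ᵐ ω ∂P,
      Integrable (prospIntegrand a P X (scaledPriceDividend a P X g) (t + 1))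
        (condExpKernel P (X.info (t + 1)) ω) ∧
      Integrable (baseIntegrand a P X (scaledPriceDividend a P X g) (t + 1))
        (condExpKernel P (X.info (t + 1)) ω) := by
  obtain ⟨δ, hδm, hδ, hδR⟩ := h
  set c : Ω → ℝ := fun ω =>
    X.ratio (t + 1) ω * X.S (t + 1) ω / δ ω / X.Cbar (t + 1) ω ^ (1 - a.θ) with hc
  have hc1 : Measurable[X.info (t + 1)] (X.Cbar (t + 1)) := Market.measurable_info_Cbar le_rfl
  have hcm : Measurable[X.info (t + 1)] c :=
    ((((hc1.div (Market.measurable_info_D le_rfl)).mul (hX.measurable_S _)).div hδm).div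
      (hc1.pow_const _))
  filter_upwards [hX.ae_ae_eq_self (t + 1) hcm, hX.ae_ae (t + 1) hδR,
    hX.integrable_Cbar_rpow hm (t + 1) 1] with ω h1 h2 h3
  have mC := hX.measurable_Cbar
  have mS := hX.measurable_S'
  have mD := hX.measurable_D
  have mg := hX.measurable_growth (t + 2)
  have mG : Measurable fun ω => G a P X (X.growth (t + 2) ω) := measurable_G.comp mg
  have mr : Measurable (X.ratio (t + 1)) := (mC _).div (mD _)
  have key : ∀ᵐ ω₁ ∂(condExpKernel P (X.info (t + 1)) ω),
      X.growth (t + 2) ω₁ ^ (1 - a.θ) * X.ratio (t + 1) ω₁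
        * ((X.S (t + 2) ω₁ + X.D (t + 2) ω₁) / X.Cbar (t + 2) ω₁)
      ≤ c ω * X.Cbar (t + 1 + 1) ω₁ ^ (1 - a.θ) := by
    filter_upwards [h1, h2] with ω₁ g1 g2
    have p1 := hX.Cbar_pos (t + 1) ω₁
    have p2 := hX.Cbar_pos (t + 2) ω₁
    have p3 := hX.S_pos (t + 1) ω₁
    have p4 := hδ ω₁
    have p5 := hX.ratio_pos (t + 1) ω₁
    have e : (X.S (t + 2) ω₁ + X.D (t + 2) ω₁) / X.Cbar (t + 2) ω₁ ≤ X.S (t + 1) ω₁ / δ ω₁ := by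
      rw [div_le_div_iff₀ p2 p4]
      rw [Market.RS, Nat.add_sub_cancel, mul_div_assoc', div_le_iff₀ p3] at g2
      change δ ω₁ * (X.S (t + 2) ω₁ + X.D (t + 2) ω₁) ≤ X.Cbar (t + 2) ω₁ * X.S (t + 1) ω₁ at g2
      linarith
    rw [← g1]
    have q1 := Real.rpow_pos_of_pos p1 (1 - a.θ)
    have q2 := Real.rpow_pos_of_pos p2 (1 - a.θ)
    calc _ ≤ X.growth (t + 2) ω₁ ^ (1 - a.θ) * X.ratio (t + 1) ω₁ * (X.S (t + 1) ω₁ / δ ω₁) :=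
          mul_le_mul_of_nonneg_left e (mul_nonneg
            (Real.rpow_nonneg (hX.growth_pos _ _).le _) p5.le)
      _ = _ := by
          simp only [Market.growth, show t + 2 - 1 = t + 1 from rfl,
            show t + 1 + 1 = t + 2 from rfl, hc]
          rw [Real.div_rpow p2.le p1.le]
          field_simp
  have hnn : ∀ ω₁, 0 ≤ X.growth (t + 2) ω₁ ^ (1 - a.θ) * X.ratio (t + 1) ω₁ := fun ω₁ =>
    mul_nonneg (Real.rpow_nonneg (hX.growth_pos _ _).le _) (hX.ratio_pos _ _).le
  have hgap := growthGap_pos hgrowth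
  constructor
  · rw [show prospIntegrand a P X (scaledPriceDividend a P X g) (t + 1) = _ from
      funext (prospIntegrand_eq hX hgrowth hg t)]
    refine (h3.1.const_mul (c ω)).mono' (Measurable.aestronglyMeasurable (by fun_prop)) ?_
    filter_upwards [key] with ω₁ g1
    have p1 := hX.Cbar_pos (t + 2) ω₁
    have p2 := hX.S_pos (t + 2) ω₁
    have p3 := hX.D_pos (t + 2) ω₁
    rw [Real.norm_of_nonneg (mul_nonneg (hnn ω₁) (by positivity))]
    -- The denominator `S + C̄` exceeds `C̄`, so the bound with `C̄` alone applies here too.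
    refine le_trans (mul_le_mul_of_nonneg_left ?_ (hnn ω₁)) g1
    exact div_le_div_of_nonneg_left (by positivity) p1 (by linarith)
  · rw [show baseIntegrand a P X (scaledPriceDividend a P X g) (t + 1) = _ from
      funext (baseIntegrand_eq hX hg t)]
    refine ((h3.1.const_mul (c ω)).mul_const ((1 + a.b * a.lam) * growthGap a P X)).mono'
      (Measurable.aestronglyMeasurable (by fun_prop)) ?_
    filter_upwards [key] with ω₁ g1
    have p1 := hX.Cbar_pos (t + 2) ω₁
    have p2 := hX.S_pos (t + 2) ω₁
    have p3 := hX.D_pos (t + 2) ω₁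
    have p4 := (G_pos (a := a) (P := P) (X := X) (X.growth (t + 2) ω₁))
    have p5 := (G_le (a := a) (P := P) (X := X) (X.growth (t + 2) ω₁))
    have p6 := mul_nonneg (hnn ω₁) (show
      0 ≤ (X.S (t + 2) ω₁ + X.D (t + 2) ω₁) / X.Cbar (t + 2) ω₁ by positivity)
    rw [Real.norm_of_nonneg (mul_nonneg p6 (by positivity))]
    exact mul_le_mul g1 (mul_le_mul_of_nonneg_right p5 hgap.le) (by positivity) (p6.trans g1)

/-- The stochastic discount factor in terms of the state variables. -/
theorem sdf_eq_of_priceDividend (heq : IsEquilibrium a P X p) (hX : X.Standing P)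
    (hatom : ∀ x : ℝ, P.map (X.growth 1) {x} = 0)
    (hm : Integrable (fun ω => a.m (X.growth 1 ω)) P)
    (hgrowth : a.β * ∫ ω, X.growth 1 ω ^ (1 - a.θ) ∂P < 1)
    (hg : ∀ t, 1 ≤ t → ∀ ω, X.S t ω / X.D t ω = g (X.growth t ω) (X.ratio t ω)) (t : ℕ) :
    ∀ᵐ ω ∂P, sdf a P X p (t + 1) ω =
      a.β / G a P X (X.growth (t + 1) ω) *
        (X.growth (t + 2) ω ^ (-a.θ) * G a P X (X.growth (t + 2) ω)
          + a.γ * X.growth (t + 2) ω ^ (-a.θ) * X.ratio (t + 2) ω *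
            ((Φ a P X (X.growth (t + 1) ω) * G a P X (X.growth (t + 2) ω)) /
              (X.ratio (t + 2) ω * G a P X (X.growth (t + 2) ω) * growthGap a P X
                + scaledPriceDividend a P X g (X.growth (t + 2) ω) (X.ratio (t + 2) ω)))) := by
  filter_upwards [sdf_eq heq hX hatom hm hgrowth t] with ω h1
  rw [h1, scaledPriceDividend_eq hg, marginalProsp, heq.wealth hX]
  have p0 := hX.Cbar_pos (t + 1) ω
  have p1 := hX.Cbar_pos (t + 2) ω
  have p2 := hX.S_pos (t + 2) ω
  have p3 := hX.D_pos (t + 2) ω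
  have p4 := (G_pos (a := a) (P := P) (X := X) (X.growth (t + 2) ω))
  have p5 := (G_pos (a := a) (P := P) (X := X) (X.growth (t + 1) ω))
  have p6 := growthGap_pos hgrowth
  have e1 : X.growth (t + 2) ω ^ (-a.θ)
      = X.Cbar (t + 2) ω ^ (-a.θ) / X.Cbar (t + 1) ω ^ (-a.θ) := by
    rw [Market.growth, show t + 2 - 1 = t + 1 from rfl, Real.div_rpow p1.le p0.le]
  have e2 : X.Cbar (t + 2) ω ^ (1 - a.θ) = X.Cbar (t + 2) ω ^ (-a.θ) * X.Cbar (t + 2) ω := by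
    rw [sub_eq_neg_add, Real.rpow_add p1, Real.rpow_one]
  have e3 : Φ a P X (X.growth (t + 1) ω) * G a P X (X.growth (t + 2) ω) /
      (X.ratio (t + 2) ω * G a P X (X.growth (t + 2) ω) * growthGap a P X
        + X.S (t + 1 + 1) ω / X.D (t + 1 + 1) ω
          * (G a P X (X.growth (t + 1 + 1) ω) * growthGap a P X))
      = Φ a P X (X.growth (t + 1) ω) * X.D (t + 2) ω
        / ((X.S (t + 2) ω + X.Cbar (t + 2) ω) * growthGap a P X) := by
    simp only [Market.ratio, show t + 1 + 1 = t + 2 from rfl]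
    rw [div_eq_div_iff (by positivity) (by positivity)]
    field_simp
    ring
  rw [e1, e2, e3, Market.ratio]
  have q0 := Real.rpow_pos_of_pos p0 (-a.θ)
  field_simp

/-- The Euler equation of the stock times `h(ε_t, Y_t)`, which is known at the trading date. Its
factor `G(ε_t)` cancels the denominator of the discount factor and its factor `S` that of the
return. The two terms of the discount factor become the prospective and the base integrand. -/
theorem solvesIntegralEquation (heq : IsEquilibrium a P X p) (hX : X.Standing P)
    (hatom : ∀ x : ℝ, P.map (X.growth 1) {x} = 0)
    (hm : Integrable (fun ω => a.m (X.growth 1 ω)) P)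
    (hgrowth : a.β * ∫ ω, X.growth 1 ω ^ (1 - a.θ) ∂P < 1)
    (hg : ∀ t, 1 ≤ t → ∀ ω, X.S t ω / X.D t ω = g (X.growth t ω) (X.ratio t ω))
    (h : TwoSidedTrade P X X.RS (t + 1)) :
    SolvesIntegralEquation a P X (scaledPriceDividend a P X g) (t + 1) := by
  set hh : Ω → ℝ := fun ω =>
    X.S (t + 1) ω / X.D (t + 1) ω * (G a P X (X.growth (t + 1) ω) * growthGap a P X) with hhd
  have mg : Measurable[X.info (t + 1)] (X.growth (t + 1)) := Market.measurable_info_growth le_rfl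
  have hhm : Measurable[X.info (t + 1)] hh :=
    ((hX.measurable_S _).div (Market.measurable_info_D le_rfl)).mul
      ((measurable_G.comp mg).mul_const _)
  have hΦm : Measurable[X.info (t + 1)] fun ω => Φ a P X (X.growth (t + 1) ω) :=
    measurable_Φ.comp mg
  filter_upwards [integrable_integrands hX hm hgrowth hg h,
    condE_sdf_mul_RS heq hX hatom hm hgrowth h,
    hX.ae_ae (t + 1) (sdf_eq heq hX hatom hm hgrowth t), hX.ae_ae_eq_self (t + 1) hhm,
    hX.ae_ae_eq_self (t + 1) hΦm] with ω h1 h2 h3 h4 h5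
  refine ⟨h1.1, h1.2, ?_⟩
  rw [scaledPriceDividend_eq hg]
  change hh ω = _
  rw [← mul_one (hh ω), ← h2, condE, condE, condE, ← mul_assoc, ← integral_const_mul,
    ← integral_const_mul, ← integral_const_mul,
    ← integral_add (h1.1.const_mul _) (h1.2.const_mul _)]
  refine integral_congr_ae ?_
  filter_upwards [h3, h4, h5] with ω₁ g3 g4 g5
  rw [← g4, ← g5, g3, prospIntegrand_eq hX hgrowth hg, baseIntegrand_eq hX hg, marginalProsp,
    heq.wealth hX]
  have p0 := hX.Cbar_pos (t + 1) ω₁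
  have p1 := hX.Cbar_pos (t + 2) ω₁
  have p2 := hX.S_pos (t + 2) ω₁
  have p2' := hX.S_pos (t + 1) ω₁
  have p3 := hX.D_pos (t + 1) ω₁
  have p5 := (G_pos (a := a) (P := P) (X := X) (X.growth (t + 1) ω₁))
  have p6 := growthGap_pos hgrowth
  have q0 := Real.rpow_pos_of_pos p0 (-a.θ)
  have e1 : X.growth (t + 2) ω₁ ^ (1 - a.θ) = X.Cbar (t + 2) ω₁ ^ (-a.θ) * X.Cbar (t + 2) ω₁
      / (X.Cbar (t + 1) ω₁ ^ (-a.θ) * X.Cbar (t + 1) ω₁) := by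
    rw [Market.growth, show t + 2 - 1 = t + 1 from rfl, Real.div_rpow p1.le p0.le,
      sub_eq_neg_add, Real.rpow_add p1, Real.rpow_add p0, Real.rpow_one, Real.rpow_one]
  have e2 : X.Cbar (t + 2) ω₁ ^ (1 - a.θ) = X.Cbar (t + 2) ω₁ ^ (-a.θ) * X.Cbar (t + 2) ω₁ := by
    rw [sub_eq_neg_add, Real.rpow_add p1, Real.rpow_one]
  rw [e1, e2, hhd]
  simp only [Market.RS, Market.ratio, show t + 2 - 1 = t + 1 from rfl]
  have p7 : X.S (t + 2) ω₁ + X.Cbar (t + 2) ω₁ ≠ 0 := by positivity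
  field_simp
  ring

end ModelI

theorem corollary1 {Ω : Type*} [MeasurableSpace Ω] [StandardBorelSpace Ω]
    (P : Measure Ω) [IsProbabilityMeasure P]
    (a : ModelI.Params) (X : ModelI.Market Ω) (p : ModelI.Plan Ω)
    (hX : X.Standing P)
    -- the law of consumption growth is atomless and has finite expected utility
    (hatom : ∀ x : ℝ, P.map (X.growth 1) {x} = 0)
    (hm : Integrable (fun ω => a.m (X.growth 1 ω)) P)
    -- growth condition
    (hgrowth : a.β * ∫ ω, X.growth 1 ω ^ (1 - a.θ) ∂P < 1)
    -- equilibrium, with a price-dividend ratio that is a function of the state variables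
    (heq : ModelI.IsEquilibrium a P X p)
    (g : ℝ → ℝ → ℝ)
    (hg : ∀ t, 1 ≤ t → ∀ ω, X.S t ω / X.D t ω = g (X.growth t ω) (X.ratio t ω)) :
    ∃ h : ℝ → ℝ → ℝ,
      (∀ t, 1 ≤ t → ∀ ω, X.S t ω / X.D t ω =
        h (X.growth t ω) (X.ratio t ω)
          / (ModelI.G a P X (X.growth t ω) * ModelI.growthGap a P X)) ∧
      (∀ t, 1 ≤ t → ∀ᵐ ω ∂P, ModelI.sdf a P X p t ω =
        a.β / ModelI.G a P X (X.growth t ω) *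
          (X.growth (t + 1) ω ^ (-a.θ) * ModelI.G a P X (X.growth (t + 1) ω)
            + a.γ * X.growth (t + 1) ω ^ (-a.θ) * X.ratio (t + 1) ω *
              ((ModelI.Φ a P X (X.growth t ω) * ModelI.G a P X (X.growth (t + 1) ω)) /
                (X.ratio (t + 1) ω * ModelI.G a P X (X.growth (t + 1) ω)
                    * ModelI.growthGap a P X
                  + h (X.growth (t + 1) ω) (X.ratio (t + 1) ω))))) ∧
      (∀ t, 1 ≤ t → ModelI.TwoSidedTrade P X X.RS t →
        (∀ᵐ ω ∂P,
          ModelI.condE P X t (fun ω' => ModelI.sdf a P X p t ω' * X.RS (t + 1) ω') ω = 1) ∧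
        ModelI.SolvesIntegralEquation a P X h t) ∧
      (∀ t, 1 ≤ t → ModelI.TwoSidedTrade P X X.Rf t →
        ∀ᵐ ω ∂P,
          ModelI.condE P X t (fun ω' => ModelI.sdf a P X p t ω' * X.Rf (t + 1) ω') ω = 1) := by

  have hk := ModelI.growthGap_pos hgrowth
  -- Writing a date `t ≥ 1` as a successor makes every truncated `t - 1` in growth rates and
  -- reference points a genuine predecessor.
  refine ⟨ModelI.scaledPriceDividend a P X g, fun t ht ω => ?_, fun t ht => ?_, fun t ht hR => ?_,
    fun t ht hR => ?_⟩ <;> obtain ⟨t, rfl⟩ := Nat.exists_eq_add_of_le' ht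
  · rw [ModelI.scaledPriceDividend_eq hg]
    have := ModelI.G_pos (a := a) (P := P) (X := X) (X.growth (t + 1) ω)
    field_simp
  · exact ModelI.sdf_eq_of_priceDividend heq hX hatom hm hgrowth hg t
  · exact ⟨ModelI.condE_sdf_mul_RS heq hX hatom hm hgrowth hR,
      ModelI.solvesIntegralEquation heq hX hatom hm hgrowth hg hR⟩
  · exact ModelI.condE_sdf_mul_Rf heq hX hatom hm hgrowth hR
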